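/- Let $k$ be an algebraically closed field of characteristic zero and let $A = k\langle x,y\rangle/(xy-yx-1)$ be the first Weyl algebra, placed in degree $0$. A (right, unital) $A_\infty$-module over $A$ is a $\mathbb{Z}$-graded vector space $K$ with operations $m_n : K\otimes A^{\otimes(n-1)}\to K$ of degree $2-n$ ($n\ge 1$) such that, for all $n\ge 1$, $$\sum_{i=1}^{n-2}(-1)^{n-i}m_{n-1}(u,a_1,\dots,a_ia_{i+1},\dots,a_{n-1})+\sum_{j=1}^{n}(-1)^{n-j}m_{n-j+1}(m_j(u,a_1,\dots,a_{j-1}),a_j,\dots,a_{n-1})=0,$$ $m_2(u,1)=u$, and $m_n(u,\dots,1,\dots)=0$ for $n\ge 3$. A morphism $f:K\to L$ is a sequence of maps $f_n:K\otimes A^{\otimes(n-1)}\to L$ of degree $1-n$ ($n\ge1$) such that, for all $n\ge 1$, $$\sum_{i=1}^{n-2}(-1)^{n-i}f_{n-1}(u,\dots,a_ia_{i+1},\dots)+\sum_{j=1}^{n}(-1)^{n-j}f_{n-j+1}(m_j(u,a_1,\dots,a_{j-1}),a_j,\dots)=\sum_{j=1}^{n}m_{n-j+1}(f_j(u,a_1,\dots,a_{j-1}),a_j,\dots).$$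 The composition is $(g\circ f)_n(u,a_1,\dots,a_{n-1})=\sum_{j=1}^{n} g_{n-j+1}(f_j(u,a_1,\dots,a_{j-1}),a_j,\dots,a_{n-1})$, and the identity morphism has first component $\mathrm{Id}$ and zero higher components. A morphism is strict if $f_n=0$ for all $n\ge 2$, and it is a quasi-isomorphism if $f_1$ induces isomorphisms on all cohomology spaces with respect to $m_1$. Let $K=K^0\oplus K^1$ be an $A_\infty$-module over $A$ with components only in degrees $0$ and $1$, and let $i\in K^0$, such that 1. $\dim_k K^1<\infty$; 2. $m_2(i,-):A\to K^0$ is an isomorphism of vector spaces; 3. $m_3(v,x,a)=0$, $m_3(v,a,y)=0$ and $m_3(v,y,x)\in k\cdot i$ for all $v\in K^1$, $a\in A$. Write $m_3(v,y,x)=\bar j(v)\,i$ with a linear functional $\bar j:K^1\to k$, put $\bar i:=m_1(i)\in K^1$, let $\bar X$, $\bar Y$ be the actions of $x$, $y$ on $K^1$ by $m_2$, and let $\lambda:A\to k$ be the linear functional $$\lambda(a):=\bar j\big(m_1(m_2(i,a))\big)=\bar j\big(m_2(\bar i,a)\big),\qquad\text{so that}\quad \lambda(x^ky^l)=\bar j\,\bar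 Y^l\bar X^k\,\bar i .$$ Let $\tilde K$ be another such $A_\infty$-module, with cyclic vector $\tilde i$ and functional $\tilde\lambda$. Then the following are equivalent: (a) $K$ and $\tilde K$ are strictly isomorphic (by mutually inverse strict morphisms); (b) $K$ and $\tilde K$ are isomorphic as $A_\infty$-modules; (c) $K$ and $\tilde K$ are quasi-isomorphic, in either of the following two senses, which are also equivalent here: (c$_1$) there is a quasi-isomorphism $K\to\tilde K$; (c$_2$) $K$ and $\tilde K$ are connected by a zigzag of quasi-isomorphisms of $A_\infty$-modules over $A$; (d) $\lambda=\tilde\lambda$. -/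

import Mathlib

universe u v w

/-! The first Weyl algebra `A₁(k) = k⟨x, y⟩ / (xy - yx - 1)`. -/

/-- The defining relation `x y = y x + 1` on the free algebra on two letters
(`0` stands for `x`, `1` for `y`). -/
inductive WeylRel (k : Type u) [Field k] :
    FreeAlgebra k (Fin 2) → FreeAlgebra k (Fin 2) → Prop
  | comm : WeylRel k (FreeAlgebra.ι k 0 * FreeAlgebra.ι k 1)
      (FreeAlgebra.ι k 1 * FreeAlgebra.ι k 0 + 1)

/-- The first Weyl algebra over `k`. -/
abbrev WeylAlgebra (k : Type u) [Field k] : Type u := RingQuot (WeylRel k)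

namespace WeylAlgebra

/-- The canonical generator `x`. -/
def x (k : Type u) [Field k] : WeylAlgebra k :=
  RingQuot.mkAlgHom k (WeylRel k) (FreeAlgebra.ι k 0)

/-- The canonical generator `y`. -/
def y (k : Type u) [Field k] : WeylAlgebra k :=
  RingQuot.mkAlgHom k (WeylRel k) (FreeAlgebra.ι k 1)

theorem x_mul_y_sub (k : Type u) [Field k] : x k * y k - y k * x k = 1 := by
  have h := RingQuot.mkAlgHom_rel k (WeylRel.comm (k := k))
  rw [map_mul, map_add, map_mul, map_one] at h
  exact sub_eq_of_eq_add' h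

/-- The Weyl algebra acts on polynomials (`x` by derivation, `y` by multiplication);
in particular it is not the zero ring. -/
theorem zero_ne_one (k : Type u) [Field k] : (0 : WeylAlgebra k) ≠ 1 := by
  let D : Module.End k (Polynomial k) := Polynomial.derivative
  let T : Module.End k (Polynomial k) := LinearMap.mulLeft k Polynomial.X
  let ρ : FreeAlgebra k (Fin 2) →ₐ[k] Module.End k (Polynomial k) :=
    FreeAlgebra.lift k ![D, T]
  have hρ : ∀ ⦃a b⦄, WeylRel k a b → ρ a = ρ b := by
    rintro _ _ ⟨⟩
    refine LinearMap.ext fun p => ?_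
    simp [ρ, D, T, add_comm]
  intro h
  have h' := congrArg (RingQuot.liftAlgHom k ⟨ρ, hρ⟩) h
  rw [map_zero, map_one] at h'
  exact _root_.zero_ne_one h'

end WeylAlgebra

/-! Operations on sequences of arguments `a₀, a₁, a₂, …` (a sequence is infinite, an operation with
`n` arguments only reads the first `n` terms). -/

/-- The first `n` terms of a sequence. -/
def seqHead {A : Type w} (n : ℕ) (a : ℕ → A) : Fin n → A := fun t => a t

/-- The sequence `a_j, a_{j+1}, …`. -/
def seqTail {A : Type w} (j : ℕ) (a : ℕ → A) : ℕ → A := fun t => a (j + t)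

/-- The sequence `a₀, …, a_{i-1}, a_i a_{i+1}, a_{i+2}, …`. -/
def seqMerge {A : Type w} [Mul A] (i : ℕ) (a : ℕ → A) : ℕ → A := fun t =>
  if t < i then a t else if t = i then a i * a (i + 1) else a (t + 1)

/-- A (right, unital) `A∞`-module over the unital associative `k`-algebra `A` (placed in degree
`0`): a `ℤ`-graded vector space `K = ⨁ Kᵖ` with operations `m_n : K ⊗ A^{⊗(n-1)} → K` of
degree `2 - n`, `n ≥ 1`. Here `op n` is `m_{n+1}`, which has `n` arguments in `A`. -/
structure AInfModule (k : Type u) [Field k] (A : Type w) [Ring A] [Algebra k A] where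
  /-- The underlying total space `K`. -/
  carrier : Type v
  [addCommGroup : AddCommGroup carrier]
  [module : Module k carrier]
  /-- The homogeneous components `Kᵖ`. -/
  gr : ℤ → Submodule k carrier
  isInternal : DirectSum.IsInternal gr
  /-- `op n` is the operation `m_{n+1}`. -/
  op : ∀ n : ℕ, carrier →ₗ[k] MultilinearMap k (fun _ : Fin n => A) carrier
  op_mem : ∀ (n : ℕ) (p : ℤ) (u : carrier) (a : Fin n → A),
    u ∈ gr p → op n u a ∈ gr (p + 1 - n)
  /-- The strong homotopy relation for `m_1, …, m_{n+1}`. -/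
  relation : ∀ (n : ℕ) (u : carrier) (a : ℕ → A),
    ∑ i ∈ Finset.range (n - 1), (-1 : k) ^ (n - i) • op (n - 1) u (seqHead (n - 1) (seqMerge i a))
    + ∑ j ∈ Finset.range (n + 1), (-1 : k) ^ (n - j) •
        op (n - j) (op j u (seqHead j a)) (seqHead (n - j) (seqTail j a)) = 0
  op_one : ∀ u : carrier, op 1 u ![1] = u
  op_unit : ∀ (n : ℕ) (u : carrier) (a : Fin n → A), 2 ≤ n → (∃ t, a t = 1) → op n u a = 0

namespace AInfModule

attribute [instance] AInfModule.addCommGroup AInfModule.module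

variable {k : Type u} [Field k] {A : Type w} [Ring A] [Algebra k A]

/-- The differential `m_1`. -/
def m₁ (K : AInfModule.{u, v, w} k A) : K.carrier →ₗ[k] K.carrier where
  toFun u := K.op 0 u ![]
  map_add' _ _ := by simp
  map_smul' _ _ := by simp

/-- The operation `m_2 : K ⊗ A → K`. -/
def m₂ (K : AInfModule.{u, v, w} k A) : K.carrier →ₗ[k] A →ₗ[k] K.carrier :=
  LinearMap.mk₂ k (fun u a => K.op 1 u ![a])
    (fun _ _ _ => by simp) (fun _ _ _ => by simp)
    (fun u a b => by
      have e (c : A) : Function.update ![(0 : A)] 0 c = ![c] := by ext t; fin_cases t; rfl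
      have h := (K.op 1 u).map_update_add ![0] 0 a b
      rwa [e, e, e] at h)
    (fun c u a => by
      have e (c : A) : Function.update ![(0 : A)] 0 c = ![c] := by ext t; fin_cases t; rfl
      have h := (K.op 1 u).map_update_smul ![0] 0 c a
      rwa [e, e] at h)

/-- The operation `m_3 : K ⊗ A ⊗ A → K`. -/
def m₃ (K : AInfModule.{u, v, w} k A) (u : K.carrier) (a b : A) : K.carrier := K.op 2 u ![a, b]

theorem m₁_mem (K : AInfModule.{u, v, w} k A) {n : ℤ} {u : K.carrier} (hu : u ∈ K.gr n) :
    K.m₁ u ∈ K.gr (n + 1) := by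
  simpa [m₁] using K.op_mem 0 n u ![] hu

theorem m₂_mem (K : AInfModule.{u, v, w} k A) {n : ℤ} {u : K.carrier} (hu : u ∈ K.gr n) (a : A) :
    K.m₂ u a ∈ K.gr n := by
  simpa [m₂] using K.op_mem 1 n u ![a] hu

/-- `m_2` commutes with `m_1`. -/
theorem m₁_m₂ (K : AInfModule.{u, v, w} k A) (u : K.carrier) (a : A) :
    K.m₁ (K.m₂ u a) = K.m₂ (K.m₁ u) a := by
  have e0 (s : Fin 0 → A) : s = ![] := Subsingleton.elim _ _
  have e1 (s : ℕ → A) : seqHead 1 s = ![s 0] := by ext t; fin_cases t; rfl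
  have h := K.relation 1 u (fun _ => a)
  simp [Finset.sum_range_succ, e0, e1, seqTail] at h
  exact (neg_add_eq_zero.1 h).symm

/-- `m_2` is associative up to the homotopy `m_3`. -/
theorem m₂_m₂_sub (K : AInfModule.{u, v, w} k A) (u : K.carrier) (a b : A) :
    K.m₂ (K.m₂ u a) b - K.m₂ u (a * b) = K.m₃ (K.m₁ u) a b + K.m₁ (K.m₃ u a b) := by
  have e0 (s : Fin 0 → A) : s = ![] := Subsingleton.elim _ _
  have e1 (s : ℕ → A) : seqHead 1 s = ![s 0] := by ext t; fin_cases t; rfl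
  have e2 (s : ℕ → A) : seqHead 2 s = ![s 0, s 1] := by ext t; fin_cases t <;> rfl
  have h := K.relation 2 u (fun t => if t = 0 then a else b)
  simp [Finset.sum_range_succ, e0, e1, e2, seqTail, seqMerge] at h
  change K.m₂ u (a * b) + (K.m₃ (K.m₁ u) a b + -K.m₂ (K.m₂ u a) b + K.m₁ (K.m₃ u a b)) = 0 at h
  rw [← sub_eq_zero, ← neg_eq_zero, ← h]
  abel

/-- The `n`-cocycles `Ker (m_1 : Kⁿ → Kⁿ⁺¹)`. -/
def cocycles (K : AInfModule.{u, v, w} k A) (n : ℤ) : Submodule k K.carrier :=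
  K.gr n ⊓ LinearMap.ker K.m₁

/-- The `n`-coboundaries `Im (m_1 : Kⁿ⁻¹ → Kⁿ)`. -/
def coboundaries (K : AInfModule.{u, v, w} k A) (n : ℤ) : Submodule k K.carrier :=
  (K.gr (n - 1)).map K.m₁

/-- The cohomology `Hⁿ(K)` with respect to `m_1`. -/
abbrev cohomology (K : AInfModule.{u, v, w} k A) (n : ℤ) : Type v :=
  K.cocycles n ⧸ (K.coboundaries n).submoduleOf (K.cocycles n)

/-- A (not necessarily strict) morphism of `A∞`-modules: maps `f_n : K ⊗ A^{⊗(n-1)} → L` of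
degree `1 - n`, `n ≥ 1`, subject to the homotopy relations. Here `map n` is `f_{n+1}`. -/
structure Hom (K L : AInfModule.{u, v, w} k A) where
  /-- `map n` is the component `f_{n+1}`. -/
  map : ∀ n : ℕ, K.carrier →ₗ[k] MultilinearMap k (fun _ : Fin n => A) L.carrier
  map_mem : ∀ (n : ℕ) (p : ℤ) (u : K.carrier) (a : Fin n → A),
    u ∈ K.gr p → map n u a ∈ L.gr (p - n)
  relation : ∀ (n : ℕ) (u : K.carrier) (a : ℕ → A),
    ∑ i ∈ Finset.range (n - 1), (-1 : k) ^ (n - i) • map (n - 1) u (seqHead (n - 1) (seqMerge i a))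
    + ∑ j ∈ Finset.range (n + 1), (-1 : k) ^ (n - j) •
        map (n - j) (K.op j u (seqHead j a)) (seqHead (n - j) (seqTail j a))
    = ∑ j ∈ Finset.range (n + 1),
        L.op (n - j) (map j u (seqHead j a)) (seqHead (n - j) (seqTail j a))

namespace Hom

variable {K L N : AInfModule.{u, v, w} k A}

/-- The first component `f_1 : K → L`. -/
def f₁ (f : Hom K L) : K.carrier →ₗ[k] L.carrier where
  toFun u := f.map 0 u ![]
  map_add' _ _ := by simp
  map_smul' _ _ := by simp

/-- `f` is strict if `f_n = 0` for all `n ≥ 2`. -/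
def IsStrict (f : Hom K L) : Prop := ∀ n : ℕ, 1 ≤ n → f.map n = 0

/-- The value of the component `(g ∘ f)_{n+1}` of the composition `g ∘ f`
on `u, a₀, …, a_{n-1}`. -/
def compApply (g : Hom L N) (f : Hom K L) (n : ℕ) (u : K.carrier) (a : ℕ → A) : N.carrier :=
  ∑ j ∈ Finset.range (n + 1),
    g.map (n - j) (f.map j u (seqHead j a)) (seqHead (n - j) (seqTail j a))

/-- `g ∘ f` is the identity morphism of `K`, whose first component is the identity map and whose
higher components vanish. -/
def CompIsId (g : Hom L K) (f : Hom K L) : Prop :=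
  ∀ (n : ℕ) (u : K.carrier) (a : ℕ → A), g.compApply f n u a = if n = 0 then u else 0

theorem f₁_m₁ (f : Hom K L) (u : K.carrier) : f.f₁ (K.m₁ u) = L.m₁ (f.f₁ u) := by
  have h := f.relation 0 u (fun _ => 0)
  have e (s : Fin 0 → A) : s = ![] := Subsingleton.elim _ _
  simpa [f₁, m₁, e] using h

theorem f₁_mem (f : Hom K L) {n : ℤ} {u : K.carrier} (hu : u ∈ K.gr n) : f.f₁ u ∈ L.gr n := by
  simpa [f₁] using f.map_mem 0 n u ![] hu

/-- The map on `n`-cocycles induced by `f_1`. -/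
def cocyclesMap (f : Hom K L) (n : ℤ) : K.cocycles n →ₗ[k] L.cocycles n :=
  f.f₁.restrict fun u hu => by
    refine ⟨f.f₁_mem hu.1, ?_⟩
    have h : K.m₁ u = 0 := hu.2
    change L.m₁ (f.f₁ u) = 0
    rw [← f.f₁_m₁, h, map_zero]

/-- The map `Hⁿ(f) : Hⁿ(K) → Hⁿ(L)` induced by `f_1`. -/
def cohomologyMap (f : Hom K L) (n : ℤ) : K.cohomology n →ₗ[k] L.cohomology n :=
  Submodule.mapQ _ _ (f.cocyclesMap n) <| by
    rintro ⟨u, hu⟩ ⟨w, hw, hwu⟩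
    exact ⟨f.f₁ w, f.f₁_mem hw, by rw [← f.f₁_m₁, hwu]; rfl⟩

/-- `f` is a quasi-isomorphism if all `Hⁿ(f)` are isomorphisms. (The maps `Hⁿ(f)` are `A`-linear
for every morphism, so that bijectivity is what has to be asked for.) -/
def IsQuasiIso (f : Hom K L) : Prop := ∀ n : ℤ, Function.Bijective (f.cohomologyMap n)

end Hom

/-- `K` and `L` are isomorphic in the category of `A∞`-modules. -/
def Isomorphic (K L : AInfModule.{u, v, w} k A) : Prop :=
  ∃ (f : Hom K L) (g : Hom L K), g.CompIsId f ∧ f.CompIsId g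

/-- `K` and `L` are isomorphic through strict morphisms. -/
def StrictlyIsomorphic (K L : AInfModule.{u, v, w} k A) : Prop :=
  ∃ (f : Hom K L) (g : Hom L K), f.IsStrict ∧ g.IsStrict ∧ g.CompIsId f ∧ f.CompIsId g

/-- `K` and `L` are connected by a zigzag of quasi-isomorphisms of `A∞`-modules. -/
def QuasiIsomorphic (K L : AInfModule.{u, v, w} k A) : Prop :=
  Relation.EqvGen (fun K L : AInfModule.{u, v, w} k A => ∃ f : Hom K L, f.IsQuasiIso) K L

end AInfModule

/-- The axioms of an `A∞`-envelope for an `A∞`-module `K = K⁰ ⊕ K¹` over the first Weyl algebra,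
with `i ∈ K⁰` as regular cyclic vector. -/
structure IsEnvelope {k : Type u} [Field k] (K : AInfModule.{u, v, u} k (WeylAlgebra k))
    (i : K.carrier) : Prop where
  two_term : ∀ p : ℤ, p ≠ 0 → p ≠ 1 → K.gr p = ⊥
  finite : FiniteDimensional k (K.gr 1)
  cyclic_mem : i ∈ K.gr 0
  cyclic : Set.BijOn (fun a => K.m₂ i a) Set.univ (K.gr 0 : Set K.carrier)
  assoc_x : ∀ v ∈ K.gr 1, ∀ a, K.m₃ v (WeylAlgebra.x k) a = 0
  assoc_y : ∀ v ∈ K.gr 1, ∀ a, K.m₃ v a (WeylAlgebra.y k) = 0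
  weak : ∀ v ∈ K.gr 1, K.m₃ v (WeylAlgebra.y k) (WeylAlgebra.x k) ∈ Submodule.span k {i}

namespace IsEnvelope

variable {k : Type u} [Field k] {K : AInfModule.{u, v, u} k (WeylAlgebra k)} {i : K.carrier}

theorem ne_zero (h : IsEnvelope K i) : i ≠ 0 := by
  rintro rfl
  exact WeylAlgebra.zero_ne_one k
    (h.cyclic.injOn (Set.mem_univ 0) (Set.mem_univ 1) (by simp))

/-- The linear functional `j̄` on `K¹` with `m_3(v, y, x) = j̄(v) i`. -/
noncomputable def jbar (h : IsEnvelope K i) : K.gr 1 →ₗ[k] k :=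
  (LinearEquiv.toSpanNonzeroSingleton k K.carrier i h.ne_zero).symm.toLinearMap ∘ₗ
    { toFun := fun v => ⟨K.m₃ v (WeylAlgebra.y k) (WeylAlgebra.x k), h.weak v v.2⟩
      map_add' := fun _ _ => by ext; simp [AInfModule.m₃]
      map_smul' := fun _ _ => by ext; simp [AInfModule.m₃] }

theorem jbar_smul (h : IsEnvelope K i) (v : K.gr 1) :
    h.jbar v • i = K.m₃ v (WeylAlgebra.y k) (WeylAlgebra.x k) :=
  congrArg Subtype.val ((LinearEquiv.toSpanNonzeroSingleton k K.carrier i h.ne_zero).apply_symm_apply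
    ⟨K.m₃ v (WeylAlgebra.y k) (WeylAlgebra.x k), h.weak v v.2⟩)

/-- The vector `ī = m_1(i) ∈ K¹`. -/
def ibar (h : IsEnvelope K i) : K.gr 1 :=
  ⟨K.m₁ i, by simpa using K.m₁_mem h.cyclic_mem⟩

/-- The action `v ↦ m_2(v, a)` of `a` on `K¹`. -/
def actBar (_h : IsEnvelope K i) (a : WeylAlgebra k) : Module.End k (K.gr 1) :=
  (K.m₂.flip a).restrict fun _ hv => K.m₂_mem hv a

/-- The linear functional `λ(a) = j̄(m_1(m_2(i, a)))` on the Weyl algebra. -/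
noncomputable def lam (h : IsEnvelope K i) : WeylAlgebra k →ₗ[k] k :=
  h.jbar ∘ₗ LinearMap.codRestrict (K.gr 1) (K.m₁ ∘ₗ K.m₂ i)
    (fun a => by simpa using K.m₁_mem (K.m₂_mem h.cyclic_mem a))

/-- `λ(a) = j̄(m_2(ī, a))`. -/
theorem lam_eq (h : IsEnvelope K i) (a : WeylAlgebra k) :
    h.lam a = h.jbar (h.actBar a h.ibar) :=
  congrArg h.jbar (Subtype.ext (K.m₁_m₂ i a))

theorem actBar_mul (h : IsEnvelope K i) {a b : WeylAlgebra k}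
    (hab : ∀ v ∈ K.gr 1, K.m₃ v a b = 0) : h.actBar (a * b) = h.actBar b * h.actBar a := by
  refine LinearMap.ext fun v => Subtype.ext ?_
  have h2 : K.m₁ v.1 = 0 := by
    have := K.m₁_mem v.2
    rwa [h.two_term _ (by norm_num) (by norm_num), Submodule.mem_bot] at this
  have e := K.m₂_m₂_sub v.1 a b
  rw [hab v v.2, h2, map_zero, add_zero] at e
  simp only [AInfModule.m₃, map_zero, zero_apply] at e
  exact (sub_eq_zero.1 e).symm

/-- `λ(x^p y^q) = j̄ Ȳ^q X̄^p ī`. -/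
theorem lam_monomial (h : IsEnvelope K i) (p q : ℕ) :
    h.lam (WeylAlgebra.x k ^ p * WeylAlgebra.y k ^ q) =
      h.jbar ((h.actBar (WeylAlgebra.y k) ^ q) ((h.actBar (WeylAlgebra.x k) ^ p) h.ibar)) := by
  have h1 : h.actBar 1 = 1 := LinearMap.ext fun v => Subtype.ext (K.op_one v)
  have hx : h.actBar (WeylAlgebra.x k ^ p) = h.actBar (WeylAlgebra.x k) ^ p := by
    induction p with
    | zero => simpa using h1
    | succ p ih => rw [pow_succ', h.actBar_mul fun v hv => h.assoc_x v hv _, ih, pow_succ]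
  have hy : h.actBar (WeylAlgebra.x k ^ p * WeylAlgebra.y k ^ q) =
      h.actBar (WeylAlgebra.y k) ^ q * h.actBar (WeylAlgebra.x k) ^ p := by
    induction q with
    | zero => simpa using hx
    | succ q ih =>
      rw [pow_succ, ← mul_assoc, h.actBar_mul fun v hv => h.assoc_y v hv _, ih, pow_succ',
        mul_assoc]
  rw [h.lam_eq, hy]
  rfl

end IsEnvelope

/-! Through `x^p y^q ↦ i · x^p y^q` the space `K⁰` becomes `k[x][y]`, written `k[X][X]` with outer
variable `y`. As `m₃(v, x, a)` and `m₃(v, a, y)` vanish, `y` acts by multiplication, and so does `x`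
on `k[x]`; as `m₃(v, y, x) = j̄(v) i`, moving `x` past `y` costs, besides the usual commutator, only
the constant `λ(u)`. So `λ` determines `m₂` on `K⁰`. The cocycles form a subspace `M = H⁰(K)` of
finite codimension, stable under `x` and `y`, on which `λ` vanishes.

`λ` determines `K`: in characteristic zero the trace forbids operators with commutator `1` on a
nonzero finite dimensional space (`Submodule.le_of_commutator_sub_mem`). On `H¹(K)` the defect `m₃`
becomes a coboundary, so `H¹(K) = 0` and `K¹ = K⁰/M`. On the image of `M̃` in `k[x][y]/M` the same
argument gives `M̃ ⊆ M`, hence equality by symmetry. Now `m₂` on `K¹` descends from `K⁰`, `m₃(m₁ u,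
a, b)` is the associator `(ua)b - u(ab)`, and the higher operations vanish by degree.

`H⁰` determines `λ`: a zigzag of quasi-isomorphisms gives an `A`-linear isomorphism `t : M → M̃`.
Finite codimension puts a nonzero `χ ∈ k[x]` and a monic polynomial in `y` into each of `M`, `M̃`.
Degrees and leading coefficients in `y` show that `t(χ) = ℓ ∈ k[x]` and that `t` multiplies leading
coefficients by `ℓ/χ`; the monic elements force `ℓ/χ` to be a constant `c`. A comparison of degrees
in `x` then gives `t = c` on `M` (`exists_map_eq_smul`). Hence both actions of `x` agree on `M`, and
this already forces `λ = λ̃` (`fn_eq_of_eqOn`). -/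

/-! ### Polynomials in two variables and their degree filtrations. -/

namespace Polynomial

/-- Induction along `f = X * g + a`, keeping track of a degree bound. -/
theorem degreeLT_induction {R : Type*} [CommRing R] {P : ℕ → R[X] → Prop} (zero : P 0 0)
    (succ : ∀ n u a, u ∈ degreeLT R n → P n u → P (n + 1) (X * u + C a)) :
    ∀ n, ∀ u ∈ degreeLT R n, P n u := by
  intro n
  induction n with
  | zero =>
    intro u hu
    have : u = 0 := by simpa [mem_degreeLT] using hu
    rwa [this]
  | succ n ih =>
    intro u hu
    have hd : u.divX ∈ degreeLT R n := by
      rw [mem_degreeLT, degree_lt_iff_coeff_zero] at hu ⊢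
      intro m hm
      rw [coeff_divX]
      exact hu _ (by omega)
    have := succ n u.divX (u.coeff 0) hd (ih _ hd)
    rwa [mul_comm, divX_mul_X_add] at this

theorem exists_mem_degreeLT {R : Type*} [CommRing R] (u : R[X]) : ∃ n, u ∈ degreeLT R n :=
  ⟨u.natDegree + 1, mem_degreeLT.2 (degree_lt_iff_coeff_zero _ _ |>.2
    fun _ hm => coeff_eq_zero_of_natDegree_lt hm)⟩

/-- Induction along `f = X * g + a`. -/
theorem X_mul_add_C_induction {R : Type*} [CommRing R] {P : R[X] → Prop} (zero : P 0)
    (succ : ∀ u a, P u → P (X * u + C a)) (u : R[X]) : P u := by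
  obtain ⟨n, hn⟩ := exists_mem_degreeLT u
  exact degreeLT_induction (P := fun _ u => P u) zero (fun _ u a _ h => succ u a h) n u hn

theorem X_mul_mem_degreeLT {R : Type*} [CommRing R] {n : ℕ} {u : R[X]} (hu : u ∈ degreeLT R n) :
    X * u ∈ degreeLT R (n + 1) := by
  rw [mem_degreeLT, degree_lt_iff_coeff_zero] at hu ⊢
  intro m hm
  obtain ⟨m, rfl⟩ : ∃ l, m = l + 1 := ⟨m - 1, by omega⟩
  rw [coeff_X_mul]
  exact hu _ (by omega)

theorem C_mul_mem_degreeLT {R : Type*} [CommRing R] {n : ℕ} {u : R[X]} (a : R)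
    (hu : u ∈ degreeLT R n) : C a * u ∈ degreeLT R n := by
  rw [← smul_eq_C_mul]; exact Submodule.smul_mem _ _ hu

theorem C_mem_degreeLT {R : Type*} [CommRing R] {n : ℕ} (hn : 0 < n) (a : R) :
    C a ∈ degreeLT R n :=
  mem_degreeLT.2 (degree_C_le.trans_lt (by exact_mod_cast hn))

theorem coeff_eq_zero_of_mem_degreeLT {R : Type*} [CommRing R] {n m : ℕ} {u : R[X]}
    (hu : u ∈ degreeLT R n) (h : n ≤ m) : u.coeff m = 0 :=
  (degree_lt_iff_coeff_zero _ _).1 (mem_degreeLT.1 hu) m h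

theorem eq_zero_of_mem_degreeLT_zero {R : Type*} [CommRing R] {u : R[X]}
    (hu : u ∈ degreeLT R 0) : u = 0 := by simpa [mem_degreeLT] using hu

theorem mem_degreeLT_natDegree {R : Type*} [CommRing R] (u : R[X]) :
    u ∈ degreeLT R (u.natDegree + 1) :=
  mem_degreeLT.2 (degree_lt_iff_coeff_zero _ _ |>.2
    fun _ hm => coeff_eq_zero_of_natDegree_lt hm)

theorem natDegree_eq_of_mem_degreeLT {R : Type*} [CommRing R] {n : ℕ} {u : R[X]}
    (hu : u ∈ degreeLT R (n + 1)) (h : u.coeff n ≠ 0) : u.natDegree = n :=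
  le_antisymm (by
    by_contra hlt
    push Not at hlt
    have h0 : u ≠ 0 := by rintro rfl; simp at h
    exact h0 (leadingCoeff_eq_zero.1 (coeff_eq_zero_of_mem_degreeLT hu hlt)))
    (le_natDegree_of_ne_zero h)

/-- The polynomials in two variables of degree `< n` in the inner variable. -/
def innerDegreeLT (k : Type*) [Field k] (n : ℕ) : Submodule k k[X][X] where
  carrier := {u | ∀ q, u.coeff q ∈ degreeLT k n}
  add_mem' hu hv q := by rw [coeff_add]; exact Submodule.add_mem _ (hu q) (hv q)
  zero_mem' q := by rw [coeff_zero]; exact Submodule.zero_mem _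
  smul_mem' c u hu q := by rw [coeff_smul]; exact Submodule.smul_mem _ _ (hu q)

section innerDegreeLT

variable {k : Type*} [Field k] {m n : ℕ} {u : k[X][X]}

theorem X_mul_mem_innerDegreeLT (hu : u ∈ innerDegreeLT k n) : X * u ∈ innerDegreeLT k n := by
  rintro (_ | q)
  · simp
  · rw [coeff_X_mul]; exact hu q

theorem innerDegreeLT_mono (h : m ≤ n) (hu : u ∈ innerDegreeLT k m) : u ∈ innerDegreeLT k n :=
  fun q => degreeLT_mono h (hu q)

theorem C_X_mul_mem_innerDegreeLT (hu : u ∈ innerDegreeLT k n) :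
    C X * u ∈ innerDegreeLT k (n + 1) := by
  intro q; rw [coeff_C_mul]; exact X_mul_mem_degreeLT (hu q)

theorem C_C_mem_innerDegreeLT (hn : 0 < n) (c : k) : (C (C c) : k[X][X]) ∈ innerDegreeLT k n := by
  rintro (_ | q)
  · simpa using C_mem_degreeLT hn c
  · simp

theorem exists_mem_innerDegreeLT (u : k[X][X]) : ∃ n, u ∈ innerDegreeLT k n := by
  induction u using X_mul_add_C_induction with
  | zero => exact ⟨0, Submodule.zero_mem _⟩
  | succ u a h =>
    obtain ⟨n, hn⟩ := h
    obtain ⟨m, hm⟩ := exists_mem_degreeLT a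
    refine ⟨max n m, Submodule.add_mem _
      (X_mul_mem_innerDegreeLT (innerDegreeLT_mono (le_max_left _ _) hn)) ?_⟩
    rintro (_ | q)
    · simpa using degreeLT_mono (le_max_right _ _) hm
    · simp

theorem smul_eq_C_C_mul (c : k) (u : k[X][X]) : c • u = C (C c) * u := by
  rw [Algebra.smul_def, IsScalarTower.algebraMap_apply k k[X] k[X][X]]; rfl

theorem C_mul_mem_innerDegreeLT {g : k[X]} (hg : g ∈ degreeLT k (n + 1))
    (hu : u ∈ innerDegreeLT k (m + 1)) : C g * u ∈ innerDegreeLT k (n + m + 1) := by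
  intro q
  rw [coeff_C_mul, mem_degreeLT]
  have h1 : g.degree ≤ n := by
    refine degree_le_iff_coeff_zero _ _ |>.2 fun l hl => coeff_eq_zero_of_mem_degreeLT hg ?_
    exact_mod_cast hl
  have h2 : (u.coeff q).degree ≤ m := by
    refine degree_le_iff_coeff_zero _ _ |>.2 fun l hl => coeff_eq_zero_of_mem_degreeLT (hu q) ?_
    exact_mod_cast hl
  refine (degree_mul_le _ _).trans_lt ((add_le_add h1 h2).trans_lt ?_)
  exact_mod_cast Nat.lt_succ_self _

theorem mem_innerDegreeLT_of_C_mul {g : k[X]} (hg : g ≠ 0)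
    (hu : C g * u ∈ innerDegreeLT k (g.natDegree + m)) : u ∈ innerDegreeLT k m := by
  intro q
  have := hu q
  rw [coeff_C_mul] at this
  by_cases h0 : u.coeff q = 0
  · rw [h0]; exact Submodule.zero_mem _
  · rw [mem_degreeLT, degree_mul, degree_eq_natDegree hg, degree_eq_natDegree h0] at this
    rw [mem_degreeLT, degree_eq_natDegree h0]
    have h3 : g.natDegree + (u.coeff q).natDegree < g.natDegree + m := by exact_mod_cast this
    exact_mod_cast (by omega : (u.coeff q).natDegree < m)

end innerDegreeLT

end Polynomial

/-! ### Subspaces of finite codimension and the trace argument. -/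

open Polynomial in
/-- If `E / N` is finite dimensional and `N` is stable under `T`, then some monic polynomial in `T`
maps `E` to `N`. -/
theorem Submodule.exists_monic_aeval_mem {k E : Type*} [Field k] [AddCommGroup E] [Module k E]
    (N : Submodule k E) [FiniteDimensional k (E ⧸ N)] (T : Module.End k E)
    (hT : ∀ u ∈ N, T u ∈ N) : ∃ g : k[X], g.Monic ∧ ∀ u, aeval T g u ∈ N := by
  let S : Module.End k (E ⧸ N) := N.mapQ N T hT
  -- Cayley–Hamilton for the operator induced on `E / N`.
  refine ⟨S.charpoly, LinearMap.charpoly_monic S, fun u => ?_⟩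
  have h : ∀ g : k[X], N.mkQ (aeval T g u) = aeval S g (N.mkQ u) := by
    intro g
    induction g using X_mul_add_C_induction with
    | zero => simp
    | succ g a ih =>
      simp only [map_add, map_mul, aeval_X, aeval_C, Module.End.mul_apply, LinearMap.add_apply,
        ← ih, Module.algebraMap_end_apply, map_smul]
      rfl
  have := h S.charpoly
  rw [LinearMap.aeval_self_charpoly] at this
  simpa using this

/-- In characteristic zero, `P Q - Q P = 1` has no solution on a nonzero finite dimensional
space. -/
theorem subsingleton_of_commutator_eq_one {k V : Type*} [Field k] [CharZero k] [AddCommGroup V]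
    [Module k V] [FiniteDimensional k V] (P Q : Module.End k V) (h : P * Q - Q * P = 1) :
    Subsingleton V := by
  have := congrArg (LinearMap.trace k V) h
  rw [map_sub, LinearMap.trace_mul_comm, sub_self, LinearMap.trace_one] at this
  exact Module.finrank_zero_iff.1 (by exact_mod_cast this.symm)

/-- A submodule stable under `P` and `Q` with `P Q - Q P = 1` modulo the submodule `N` is contained
in `N`, if `N` has finite codimension and the characteristic is zero. -/
theorem Submodule.le_of_commutator_sub_mem {k E : Type*} [Field k] [CharZero k] [AddCommGroup E]
    [Module k E] (N N' : Submodule k E) [FiniteDimensional k (E ⧸ N)] (P Q : Module.End k E)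
    (hP : ∀ u ∈ N, P u ∈ N) (hQ : ∀ u ∈ N, Q u ∈ N)
    (hP' : ∀ u ∈ N', P u ∈ N') (hQ' : ∀ u ∈ N', Q u ∈ N')
    (h : ∀ u ∈ N', P (Q u) - Q (P u) - u ∈ N) : N' ≤ N := by
  -- On the image of `N'` in `E / N` the commutator relation holds exactly, so this image is zero.
  let W : Submodule k (E ⧸ N) := N'.map N.mkQ
  have hW (T : Module.End k E) (hT : ∀ u ∈ N, T u ∈ N) (hT' : ∀ u ∈ N', T u ∈ N') :
      ∀ w ∈ W, N.mapQ N T hT w ∈ W := by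
    rintro _ ⟨u, hu, rfl⟩
    exact ⟨T u, hT' u hu, rfl⟩
  have : Subsingleton W := by
    refine subsingleton_of_commutator_eq_one (k := k)
      ((N.mapQ N P hP).restrict (hW P hP hP')) ((N.mapQ N Q hQ).restrict (hW Q hQ hQ')) ?_
    refine LinearMap.ext ?_
    rintro ⟨_, u, hu, rfl⟩
    refine Subtype.ext ?_
    have := (Submodule.Quotient.mk_eq_zero N).2 (h u hu)
    rw [Submodule.Quotient.mk_sub, sub_eq_zero, Submodule.Quotient.mk_sub] at this
    exact this
  intro u hu
  have h1 : (⟨N.mkQ u, u, hu, rfl⟩ : W) = 0 := Subsingleton.elim _ _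
  exact (Submodule.Quotient.mk_eq_zero N).1 (congrArg Subtype.val h1)

/-! ### The linear model of `K⁰`. -/

open Polynomial in
/-- A linear model of the degree-zero part of an envelope: the space `k[x][y]`, in which the
monomial `x^p y^q` stands for `i · x^p y^q`, with the action `opX` of `x`, the functional `fn`
measuring the failure of associativity, and the subspace `sub` of cocycles; `y` acts by
multiplication. -/
structure CyclicDatum (k : Type u) [Field k] where
  opX : Module.End k k[X][X]
  fn : k[X][X] →ₗ[k] k
  sub : Submodule k k[X][X]
  opX_C : ∀ p : k[X], opX (C p) = C (X * p)
  -- For a right action `xy = yx + 1` reads `(uy)x = (ux)y - u`; the constant is the defect `m₃(m₁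
  -- u, y, x)`, a multiple of `i`, which corresponds to `1`.
  opX_X_mul : ∀ u, opX (X * u) = X * opX u - u + C (C (fn u))
  opX_mem : ∀ u ∈ sub, opX u ∈ sub
  X_mul_mem : ∀ u ∈ sub, X * u ∈ sub
  fn_eq_zero : ∀ u ∈ sub, fn u = 0
  finite : FiniteDimensional k (k[X][X] ⧸ sub)

namespace CyclicDatum

open Polynomial

variable {k : Type u} [Field k] (d e : CyclicDatum k)

/-! ### The filtration by the degree in `y`. -/

/-- Both the commutator and the constant have lower degree in `y`, so the leading part of the action
of `x` is ordinary multiplication. -/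
theorem opX_sub_mem_degreeLT {n : ℕ} {u : k[X][X]} (hu : u ∈ degreeLT k[X] n) :
    d.opX u - C X * u ∈ degreeLT k[X] (n - 1) := by
  refine degreeLT_induction (P := fun n u => d.opX u - C X * u ∈ degreeLT k[X] (n - 1)) ?_ ?_
    n u hu
  · simp
  · intro n u a hu ih
    have e1 : d.opX (X * u + C a) - C X * (X * u + C a)
        = X * (d.opX u - C X * u) - u + C (C (d.fn u)) := by
      rw [map_add, d.opX_X_mul, d.opX_C, C_mul]; ring
    rw [e1, Nat.add_sub_cancel]
    rcases Nat.eq_zero_or_pos n with rfl | hn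
    · rw [eq_zero_of_mem_degreeLT_zero hu]; simp
    · refine Submodule.add_mem _ (Submodule.sub_mem _ ?_ hu) (C_mem_degreeLT hn _)
      have := X_mul_mem_degreeLT ih
      rwa [Nat.sub_add_cancel hn] at this

theorem aeval_opX_succ (g : k[X]) (a : k) (u : k[X][X]) :
    aeval d.opX (X * g + C a) u = d.opX (aeval d.opX g u) + a • u := by
  simp

theorem aeval_opX_sub_mem_degreeLT (g : k[X]) {n : ℕ} {u : k[X][X]} (hu : u ∈ degreeLT k[X] n) :
    aeval d.opX g u - C g * u ∈ degreeLT k[X] (n - 1) := by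
  induction g using X_mul_add_C_induction with
  | zero => simp
  | succ g a ih =>
    have e1 : aeval d.opX (X * g + C a) u - C (X * g + C a) * u
        = (d.opX (aeval d.opX g u) - C X * aeval d.opX g u)
          + C X * (aeval d.opX g u - C g * u) := by
      rw [aeval_opX_succ, C_add, C_mul, smul_eq_C_C_mul]
      ring
    have h2 : aeval d.opX g u ∈ degreeLT k[X] n := by
      rw [← sub_add_cancel (aeval d.opX g u) (C g * u)]
      exact Submodule.add_mem _ (degreeLT_mono (Nat.sub_le _ _) ih) (C_mul_mem_degreeLT _ hu)
    rw [e1]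
    exact Submodule.add_mem _ (d.opX_sub_mem_degreeLT h2) (C_mul_mem_degreeLT _ ih)

theorem aeval_opX_mem_degreeLT (g : k[X]) {n : ℕ} {u : k[X][X]} (hu : u ∈ degreeLT k[X] n) :
    aeval d.opX g u ∈ degreeLT k[X] n := by
  rw [← sub_add_cancel (aeval d.opX g u) (C g * u)]
  exact Submodule.add_mem _ (degreeLT_mono (Nat.sub_le _ _) (d.aeval_opX_sub_mem_degreeLT g hu))
    (C_mul_mem_degreeLT _ hu)

theorem coeff_aeval_opX (g : k[X]) {n : ℕ} {u : k[X][X]} (hu : u ∈ degreeLT k[X] (n + 1)) :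
    (aeval d.opX g u).coeff n = g * u.coeff n := by
  have := coeff_eq_zero_of_mem_degreeLT (d.aeval_opX_sub_mem_degreeLT g hu) (le_refl n)
  rwa [coeff_sub, coeff_C_mul, sub_eq_zero] at this

theorem aeval_opX_C (g p : k[X]) : aeval d.opX g (C p) = C (g * p) := by
  induction g using X_mul_add_C_induction with
  | zero => simp
  | succ g a ih =>
    rw [aeval_opX_succ, ih, d.opX_C, add_mul, C_add, mul_assoc, smul_C, smul_eq_C_mul]

theorem natDegree_aeval_opX {g : k[X]} (hg : g ≠ 0) {u : k[X][X]} (hu : u ≠ 0) :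
    (aeval d.opX g u).natDegree = u.natDegree := by
  refine natDegree_eq_of_mem_degreeLT (d.aeval_opX_mem_degreeLT g (mem_degreeLT_natDegree u)) ?_
  rw [d.coeff_aeval_opX g (mem_degreeLT_natDegree u)]
  exact mul_ne_zero hg (leadingCoeff_ne_zero.2 hu)

theorem leadingCoeff_aeval_opX {g : k[X]} (hg : g ≠ 0) {u : k[X][X]} (hu : u ≠ 0) :
    (aeval d.opX g u).leadingCoeff = g * u.leadingCoeff := by
  rw [leadingCoeff, d.natDegree_aeval_opX hg hu, d.coeff_aeval_opX g (mem_degreeLT_natDegree u)]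
  rfl

theorem aeval_opX_mem (g : k[X]) {u : k[X][X]} (hu : u ∈ d.sub) : aeval d.opX g u ∈ d.sub :=
  aeval_apply_smul_mem_of_le_comap hu g d.opX d.opX_mem

/-- Some monic `g(x)` maps everything into the finite-codimensional subspace; applied to `1` it
gives `g` itself. -/
theorem exists_C_mem : ∃ p : k[X], p ≠ 0 ∧ C p ∈ d.sub := by
  have := d.finite
  obtain ⟨g, hg, h⟩ := d.sub.exists_monic_aeval_mem d.opX d.opX_mem
  refine ⟨g, hg.ne_zero, ?_⟩
  simpa only [d.aeval_opX_C, mul_one] using h (C 1)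

theorem exists_monic_mul_mem : ∃ g : k[X][X], g.Monic ∧ (∃ h : k[X], g = h.map C) ∧
    ∀ u, g * u ∈ d.sub := by
  have := d.finite
  obtain ⟨g, hg, h⟩ := d.sub.exists_monic_aeval_mem (LinearMap.mulLeft k (X : k[X][X]))
    d.X_mul_mem
  refine ⟨g.map C, hg.map _, ⟨g, rfl⟩, fun u => ?_⟩
  convert h u using 1
  clear h hg
  induction g using X_mul_add_C_induction with
  | zero => simp
  | succ g a ih =>
    have : aeval (LinearMap.mulLeft k (X : k[X][X])) (X * g + C a) u
      = X * aeval (LinearMap.mulLeft k (X : k[X][X])) g u + a • u := by simp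
    rw [this, ← ih]
    simp only [Polynomial.map_add, Polynomial.map_mul, map_X, map_C]
    rw [smul_eq_C_C_mul]
    ring

/-! ### The space `χ k[x][y]` inside the cocycles. -/

section chi

variable {d} {χ : k[X]} (hχ : C χ ∈ d.sub)
include hχ

/-- The subspace is stable under `opX`, not visibly under multiplication by `C X`; but on `k[x]` the
two coincide, and powers of `y` are multiplied in afterwards. -/
theorem C_mul_mem (w : k[X][X]) : C χ * w ∈ d.sub := by
  induction w using X_mul_add_C_induction with
  | zero => simp
  | succ w p ih =>
    have : C χ * (X * w + C p) = X * (C χ * w) + aeval d.opX p (C χ) := by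
      rw [aeval_opX_C, C_mul]; ring
    rw [this]
    exact Submodule.add_mem _ (d.X_mul_mem _ ih) (d.aeval_opX_mem p hχ)

theorem exists_opX_C_mul (w : k[X][X]) : ∃ w', d.opX (C χ * w) = C χ * w' := by
  induction w using X_mul_add_C_induction with
  | zero => exact ⟨0, by simp⟩
  | succ w p ih =>
    obtain ⟨w', hw⟩ := ih
    refine ⟨X * w' - w + C (X * p), ?_⟩
    have : C χ * (X * w + C p) = X * (C χ * w) + C (χ * p) := by rw [C_mul]; ring
    -- The constant, the only term that might not be divisible by `χ`, vanishes on cocycles.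
    rw [this, map_add, d.opX_X_mul, hw, d.fn_eq_zero _ (C_mul_mem hχ w), d.opX_C]
    simp only [C_mul, map_zero]
    ring

theorem exists_aeval_C_mul (g : k[X]) (w : k[X][X]) :
    ∃ w', aeval d.opX g (C χ * w) = C χ * w' := by
  induction g using X_mul_add_C_induction with
  | zero => exact ⟨0, by simp⟩
  | succ g a ih =>
    obtain ⟨w₁, h₁⟩ := ih
    obtain ⟨w₂, h₂⟩ := exists_opX_C_mul hχ w₁
    refine ⟨w₂ + C (C a) * w, ?_⟩
    rw [aeval_opX_succ, h₁, h₂, smul_eq_C_C_mul, mul_add, mul_left_comm (C χ)]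

/-- An Ore-type condition: `χ(x)` sends `m` to `χ m` plus a remainder of lower degree in `y`, and
induction supplies a multiplier for the remainder. -/
theorem exists_aeval_eq_C_mul (h0 : χ ≠ 0) (m : k[X][X]) :
    ∃ g : k[X], g ≠ 0 ∧ ∃ w, aeval d.opX g m = C χ * w := by
  obtain ⟨n, hn⟩ := exists_mem_degreeLT m
  induction n generalizing m with
  | zero => exact ⟨1, one_ne_zero, 0, by rw [eq_zero_of_mem_degreeLT_zero hn]; simp⟩
  | succ n ih =>
    have hr := d.aeval_opX_sub_mem_degreeLT χ hn
    rw [Nat.add_sub_cancel] at hr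
    obtain ⟨g, hg, w₁, h₁⟩ := ih _ hr
    obtain ⟨w₂, h₂⟩ := exists_aeval_C_mul hχ g m
    refine ⟨g * χ, mul_ne_zero hg h0, w₁ + w₂, ?_⟩
    rw [map_sub, h₂, sub_eq_iff_eq_add] at h₁
    rw [map_mul, Module.End.mul_apply, h₁, mul_add]

end chi

/-! The filtration by the degree in `x`. -/

theorem opX_sub_mem_innerDegreeLT {n : ℕ} {u : k[X][X]} (hu : u ∈ innerDegreeLT k n) :
    d.opX u - C X * u ∈ innerDegreeLT k n := by
  rcases Nat.eq_zero_or_pos n with rfl | hn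
  -- The bound `0` is separate because the added constant lies in `innerDegreeLT k n` only for `n >
  -- 0`.
  · have : u = 0 := by ext1 q; exact eq_zero_of_mem_degreeLT_zero (hu q)
    rw [this]; simp
  induction u using X_mul_add_C_induction with
  | zero => simp
  | succ u a ih =>
    have h1 : u ∈ innerDegreeLT k n := fun q => by simpa [coeff_C] using hu (q + 1)
    have e1 : d.opX (X * u + C a) - C X * (X * u + C a)
        = X * (d.opX u - C X * u) - u + C (C (d.fn u)) := by
      rw [map_add, d.opX_X_mul, d.opX_C, C_mul]; ring
    rw [e1]
    exact Submodule.add_mem _ (Submodule.sub_mem _ (X_mul_mem_innerDegreeLT (ih h1)) h1)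
      (C_C_mem_innerDegreeLT hn _)

theorem opX_mem_innerDegreeLT {n : ℕ} {u : k[X][X]} (hu : u ∈ innerDegreeLT k n) :
    d.opX u ∈ innerDegreeLT k (n + 1) := by
  rw [← sub_add_cancel (d.opX u) (C X * u)]
  exact Submodule.add_mem _ (innerDegreeLT_mono (Nat.le_succ n) (d.opX_sub_mem_innerDegreeLT hu))
    (C_X_mul_mem_innerDegreeLT hu)

theorem aeval_opX_sub_mem_innerDegreeLT {n m : ℕ} {g : k[X]} (hg : g ∈ degreeLT k (n + 1))
    {u : k[X][X]} (hu : u ∈ innerDegreeLT k (m + 1)) :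
    aeval d.opX g u - C g * u ∈ innerDegreeLT k (n + m) := by
  suffices H : ∀ n, ∀ g ∈ degreeLT k n,
      aeval d.opX g u - C g * u ∈ innerDegreeLT k (n - 1 + m) by simpa using H _ g hg
  refine degreeLT_induction (by simp) fun n g a hg ih => ?_
  have e1 : aeval d.opX (X * g + C a) u - C (X * g + C a) * u
      = (d.opX (aeval d.opX g u) - C X * aeval d.opX g u)
        + C X * (aeval d.opX g u - C g * u) := by
    rw [aeval_opX_succ, C_add, C_mul, smul_eq_C_C_mul]
    ring
  rw [e1, Nat.add_sub_cancel]
  rcases n with _ | n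
  · rw [eq_zero_of_mem_degreeLT_zero hg]; simp
  · rw [Nat.add_sub_cancel] at ih
    have h2 : aeval d.opX g u ∈ innerDegreeLT k (n + m + 1) := by
      rw [← sub_add_cancel (aeval d.opX g u) (C g * u)]
      exact Submodule.add_mem _ (innerDegreeLT_mono (Nat.le_succ _) ih)
        (C_mul_mem_innerDegreeLT hg hu)
    have e2 : n + 1 + m = n + m + 1 := by ring
    rw [e2]
    exact Submodule.add_mem _ (d.opX_sub_mem_innerDegreeLT h2) (C_X_mul_mem_innerDegreeLT ih)

/-- The leading part in `x` of `g(x)` acting is multiplication by `g`, which raises the degree in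
`x` by exactly `deg g`. -/
theorem eq_zero_of_aeval_opX_mem {g : k[X]} (hg : g ≠ 0) {z : k[X][X]}
    (h : aeval d.opX g z ∈ innerDegreeLT k g.natDegree) : z = 0 := by
  obtain ⟨s, hs⟩ := exists_mem_innerDegreeLT z
  induction s with
  | zero => ext1 q; exact eq_zero_of_mem_degreeLT_zero (hs q)
  | succ s ih =>
    refine ih (mem_innerDegreeLT_of_C_mul hg ?_)
    have h1 := d.aeval_opX_sub_mem_innerDegreeLT (mem_degreeLT_natDegree g) hs
    rw [← sub_sub_cancel (aeval d.opX g z) (C g * z)]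
    exact Submodule.sub_mem _ (innerDegreeLT_mono (Nat.le_add_right _ _) h) h1

theorem opX_sub_opX_X_mul (u : k[X][X]) : d.opX (X * u) - e.opX (X * u) =
    X * (d.opX u - e.opX u) + C (C (d.fn u - e.fn u)) := by
  rw [d.opX_X_mul, e.opX_X_mul, C_sub, C_sub]; ring

theorem opX_sub_opX_mem (u : k[X][X]) : d.opX u - e.opX u ∈ innerDegreeLT k 1 := by
  induction u using X_mul_add_C_induction with
  | zero => simp
  | succ u a ih =>
    rw [map_add, map_add, d.opX_C, e.opX_C, add_sub_add_right_eq_sub, opX_sub_opX_X_mul]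
    exact Submodule.add_mem _ (X_mul_mem_innerDegreeLT ih) (C_C_mem_innerDegreeLT one_pos _)

theorem aeval_opX_sub_aeval_opX_mem {n : ℕ} {g : k[X]} (hg : g ∈ degreeLT k (n + 1))
    (u : k[X][X]) : aeval d.opX g u - aeval e.opX g u ∈ innerDegreeLT k n := by
  suffices H : ∀ n, ∀ g ∈ degreeLT k n,
      aeval d.opX g u - aeval e.opX g u ∈ innerDegreeLT k (n - 1) by simpa using H _ g hg
  refine degreeLT_induction (by simp) fun n g a hg ih => ?_
  have e1 : aeval d.opX (X * g + C a) u - aeval e.opX (X * g + C a) u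
      = (d.opX (aeval d.opX g u) - e.opX (aeval d.opX g u))
        + e.opX (aeval d.opX g u - aeval e.opX g u) := by
    rw [aeval_opX_succ, aeval_opX_succ, map_sub]; abel
  rw [e1, Nat.add_sub_cancel]
  rcases n with _ | n
  · rw [eq_zero_of_mem_degreeLT_zero hg]; simp
  · exact Submodule.add_mem _ (innerDegreeLT_mono (by omega) (opX_sub_opX_mem d e _))
      (e.opX_mem_innerDegreeLT ih)

/-- The two actions of `g(x)` differ by terms of degree `< deg g` in `x`, too small to be the image
of a nonzero `u - m`. This cancels `g` across two different actions. -/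
theorem eq_of_aeval_opX_eq {g : k[X]} (hg : g ≠ 0) {m u : k[X][X]}
    (h : aeval e.opX g u = aeval d.opX g m) : u = m := by
  refine sub_eq_zero.1 (e.eq_zero_of_aeval_opX_mem hg ?_)
  rw [map_sub, h]
  exact aeval_opX_sub_aeval_opX_mem d e (mem_degreeLT_natDegree g) m

/-- If the actions of `x` agree on the subspace of finite codimension, the functionals agree. -/
theorem fn_eq_of_eqOn (h : ∀ u ∈ d.sub, d.opX u = e.opX u) : d.fn = e.fn := by
  obtain ⟨_, hψ, ⟨g, rfl⟩, hmem⟩ := d.exists_monic_mul_mem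
  -- The difference `D` of the two actions commutes with `y` up to constants, hence with `g(y)` up
  -- to degree `< deg g` in `y`.
  have hg : ∀ n, ∀ g ∈ degreeLT k n, ∀ u,
      (d.opX (g.map C * u) - e.opX (g.map C * u)) - g.map C * (d.opX u - e.opX u)
        ∈ degreeLT k[X] (n - 1) := by
    refine degreeLT_induction (by simp) fun n g a hg ih u => ?_
    rw [Nat.add_sub_cancel]
    have e1 : (X * g + C a).map C * u = X * (g.map C * u) + a • u := by
      rw [smul_eq_C_C_mul]
      simp only [Polynomial.map_add, Polynomial.map_mul, map_X, map_C]
      ring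
    have e2 : (X * g + C a).map C * (d.opX u - e.opX u)
        = X * (g.map C * (d.opX u - e.opX u)) + a • (d.opX u - e.opX u) := by
      rw [smul_eq_C_C_mul]
      simp only [Polynomial.map_add, Polynomial.map_mul, map_X, map_C]
      ring
    have e3 : (d.opX ((X * g + C a).map C * u) - e.opX ((X * g + C a).map C * u))
          - (X * g + C a).map C * (d.opX u - e.opX u)
        = X * ((d.opX (g.map C * u) - e.opX (g.map C * u)) - g.map C * (d.opX u - e.opX u))
          + C (C (d.fn (g.map C * u) - e.fn (g.map C * u))) := by
      rw [e2, e1, map_add, map_add, add_sub_add_comm, opX_sub_opX_X_mul, map_smul, map_smul,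
        smul_sub]
      ring
    rw [e3]
    rcases Nat.eq_zero_or_pos n with rfl | hn
    · rw [eq_zero_of_mem_degreeLT_zero hg]; simp
    · refine Submodule.add_mem _ ?_ (C_mem_degreeLT hn _)
      have := X_mul_mem_degreeLT (ih u)
      rwa [Nat.sub_add_cancel hn] at this
  -- As `g(y) u` lies in the subspace, `D(g u) = 0`; so `g · D u` has degree `< deg g` with `g`
  -- monic, which forces `D u = 0`.
  have hD : ∀ u, d.opX u - e.opX u = 0 := by
    intro u
    have h1 := hg _ g (mem_degreeLT_natDegree g) u
    rw [h _ (hmem u), sub_self, zero_sub, neg_mem_iff, Nat.add_sub_cancel, mem_degreeLT] at h1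
    by_contra h0
    rw [mul_comm, hψ.degree_mul, add_comm, degree_map_eq_of_injective (C_injective),
      degree_eq_natDegree (show g ≠ 0 by rintro rfl; simpa using hψ.ne_zero),
      degree_eq_natDegree h0] at h1
    have : g.natDegree + (d.opX u - e.opX u).natDegree < g.natDegree := by exact_mod_cast h1
    omega
  refine LinearMap.ext fun u => ?_
  have h1 := opX_sub_opX_X_mul d e u
  rw [hD, hD, mul_zero, zero_add, eq_comm, C_eq_zero, C_eq_zero, sub_eq_zero] at h1
  exact h1

/-! ### Rigidity of isomorphisms between spaces of cocycles. -/

section rigidity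

variable {d e} (t : d.sub →ₗ[k] k[X][X])
  (htX : ∀ u : d.sub, t ⟨d.opX u, d.opX_mem u u.2⟩ = e.opX (t u))
  (htY : ∀ u : d.sub, t ⟨X * (u : k[X][X]), d.X_mul_mem u u.2⟩ = X * t u)

include htX in
theorem map_aeval (g : k[X]) (u : d.sub) :
    t ⟨aeval d.opX g u, d.aeval_opX_mem g u.2⟩ = aeval e.opX g (t u) := by
  induction g using X_mul_add_C_induction with
  | zero => simp only [map_zero, LinearMap.zero_apply]; exact map_zero t
  | succ g a ih =>
    simp only [aeval_opX_succ]
    rw [← ih, ← htX, ← map_smul, ← map_add]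
    rfl

include htX htY in
theorem map_C_mul_succ {χ : k[X]} (hχ : C χ ∈ d.sub) (w : k[X][X]) (p : k[X]) :
    t ⟨C χ * (X * w + C p), C_mul_mem hχ _⟩
      = X * t ⟨C χ * w, C_mul_mem hχ w⟩ + aeval e.opX p (t ⟨C χ, hχ⟩) := by
  rw [← map_aeval t htX, ← htY, ← map_add]
  congr 1
  refine Subtype.ext ?_
  change C χ * (X * w + C p) = X * (C χ * w) + aeval d.opX p (C χ)
  rw [aeval_opX_C, C_mul]; ring

include htX htY in
theorem map_C_mul_mem {χ : k[X]} (hχ : C χ ∈ d.sub) {r : ℕ}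
    (hr : t ⟨C χ, hχ⟩ ∈ degreeLT k[X] (r + 1)) (n : ℕ) (w : k[X][X])
    (hw : w ∈ degreeLT k[X] (n + 1)) :
    t ⟨C χ * w, C_mul_mem hχ w⟩ ∈ degreeLT k[X] (r + n + 1) ∧
    (t ⟨C χ * w, C_mul_mem hχ w⟩).coeff (r + n) = (t ⟨C χ, hχ⟩).coeff r * w.coeff n := by
  -- Shifted by one so that the induction can start at `w = 0`.
  suffices H : ∀ n, ∀ w ∈ degreeLT k[X] n, t ⟨C χ * w, C_mul_mem hχ w⟩ ∈ degreeLT k[X] (r + n) ∧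
      ∀ m, n = m + 1 → (t ⟨C χ * w, C_mul_mem hχ w⟩).coeff (r + m)
        = (t ⟨C χ, hχ⟩).coeff r * w.coeff m by
    exact ⟨(H _ w hw).1, (H _ w hw).2 n rfl⟩
  refine degreeLT_induction ?_ fun n w p hw ih => ⟨?_, ?_⟩
  · have : (⟨C χ * 0, C_mul_mem hχ 0⟩ : d.sub) = 0 := Subtype.ext (mul_zero _)
    rw [this, map_zero]
    exact ⟨Submodule.zero_mem _, fun m hm => by omega⟩
  · rw [map_C_mul_succ t htX htY hχ]
    exact Submodule.add_mem _ (X_mul_mem_degreeLT ih.1)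
      (degreeLT_mono (by omega) (e.aeval_opX_mem_degreeLT p hr))
  · rintro m hm
    obtain rfl : n = m := by omega
    rw [map_C_mul_succ t htX htY hχ, coeff_add]
    rcases n with _ | n
    · obtain rfl := eq_zero_of_mem_degreeLT_zero hw
      have : (⟨C χ * 0, C_mul_mem hχ 0⟩ : d.sub) = 0 := Subtype.ext (mul_zero _)
      rw [this, map_zero]
      simp [e.coeff_aeval_opX p hr, mul_comm]
    · rw [← add_assoc, coeff_X_mul, ih.2 n rfl,
        coeff_eq_zero_of_mem_degreeLT (e.aeval_opX_mem_degreeLT p hr) (by omega)]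
      simp

include htX htY in
-- Choose `g` with `g(x)` sending `m` to `χ w`. On both sides `g(x)` keeps the degree in `y` and
-- multiplies the leading coefficient by `g`, so the claim reduces to `χ w`, and `g` cancels.
theorem natDegree_map (hinj : Function.Injective t) {χ : k[X]} (h0 : χ ≠ 0) (hχ : C χ ∈ d.sub)
    (m : d.sub) (hm : m ≠ 0) :
    (t m).natDegree = (t ⟨C χ, hχ⟩).natDegree + (m : k[X][X]).natDegree ∧
    χ * (t m).leadingCoeff = (t ⟨C χ, hχ⟩).leadingCoeff * (m : k[X][X]).leadingCoeff := by
  obtain ⟨g, hg, w, hw⟩ := exists_aeval_eq_C_mul hχ h0 (m : k[X][X])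
  have hm' : (m : k[X][X]) ≠ 0 := fun h => hm (Subtype.ext h)
  have htm : t m ≠ 0 := fun h => hm (hinj (h.trans (map_zero t).symm))
  have hb : t ⟨C χ, hχ⟩ ≠ 0 := fun h => h0 (by
    simpa using congrArg Subtype.val (hinj (h.trans (map_zero t).symm)))
  have e1 : aeval e.opX g (t m) = t ⟨C χ * w, C_mul_mem hχ w⟩ := by
    rw [← map_aeval t htX]
    exact congrArg t (Subtype.ext hw)
  have hw0 : w ≠ 0 := by
    rintro rfl
    have h1 := d.leadingCoeff_aeval_opX hg hm'
    rw [hw, mul_zero, leadingCoeff_zero, eq_comm, mul_eq_zero, leadingCoeff_eq_zero] at h1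
    exact h1.elim hg hm'
  have dw := d.natDegree_aeval_opX hg hm'
  have lw := d.leadingCoeff_aeval_opX hg hm'
  rw [hw, natDegree_C_mul h0] at dw
  rw [hw, leadingCoeff_mul, leadingCoeff_C] at lw
  obtain ⟨h1, h2⟩ := map_C_mul_mem t htX htY hχ (mem_degreeLT_natDegree _) _ w
    (mem_degreeLT_natDegree w)
  have hne : (t ⟨C χ, hχ⟩).leadingCoeff * w.leadingCoeff ≠ 0 :=
    mul_ne_zero (leadingCoeff_ne_zero.2 hb) (leadingCoeff_ne_zero.2 hw0)
  have h3 := natDegree_eq_of_mem_degreeLT h1 (h2.trans_ne hne)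
  have h4 : (t ⟨C χ * w, C_mul_mem hχ w⟩).leadingCoeff
      = (t ⟨C χ, hχ⟩).leadingCoeff * w.leadingCoeff := by
    rw [leadingCoeff, h3, h2]; rfl
  rw [← e1, e.natDegree_aeval_opX hg htm] at h3
  rw [← e1, e.leadingCoeff_aeval_opX hg htm] at h4
  refine ⟨by rw [h3, dw], mul_left_cancel₀ hg ?_⟩
  rw [mul_left_comm, h4, mul_left_comm, lw]
  ring

include htX htY in
/-- A bijection of the subspaces that commutes with the actions of `x` and `y` is a scalar. -/
theorem exists_map_eq_smul (hinj : Function.Injective t) (hran : LinearMap.range t = e.sub) :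
    ∃ c : k, c ≠ 0 ∧ ∀ m : d.sub, t m = c • (m : k[X][X]) := by
  obtain ⟨χ, h0, hχ⟩ := d.exists_C_mem
  have key := natDegree_map t htX htY hinj h0 hχ
  -- The target also contains an element of degree `0` in `y`, while every value of `t` at a nonzero
  -- element has at least the degree of `t(χ)`.
  have hdeg : (t ⟨C χ, hχ⟩).natDegree = 0 := by
    obtain ⟨χ', h0', hχ'⟩ := e.exists_C_mem
    rw [← hran] at hχ'
    obtain ⟨m, hm⟩ := hχ'
    have hm0 : m ≠ 0 := by
      rintro rfl
      rw [map_zero, eq_comm, C_eq_zero] at hm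
      exact h0' hm
    have := (key m hm0).1
    rw [hm, natDegree_C] at this
    omega
  obtain ⟨ℓ, hℓ⟩ : ∃ ℓ, t ⟨C χ, hχ⟩ = C ℓ := ⟨_, eq_C_of_natDegree_eq_zero hdeg⟩
  have key2 (m : d.sub) (hm : m ≠ 0) :
      χ * (t m).leadingCoeff = ℓ * (m : k[X][X]).leadingCoeff := by
    have := (key m hm).2
    rwa [hℓ, leadingCoeff_C] at this
  -- A monic element of the source gives `χ ∣ ℓ`; below, a monic element of the target makes the
  -- quotient a unit.
  obtain ⟨q, rfl⟩ : χ ∣ ℓ := by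
    obtain ⟨ψ, hψ, -, hmem⟩ := d.exists_monic_mul_mem
    have h1 := hmem 1
    rw [mul_one] at h1
    have := key2 ⟨ψ, h1⟩ fun h => hψ.ne_zero (congrArg Subtype.val h)
    rw [hψ.leadingCoeff, mul_one] at this
    exact ⟨_, this.symm⟩
  have hq : IsUnit q := by
    obtain ⟨ψ, hψ, -, hmem⟩ := e.exists_monic_mul_mem
    have h1 := hmem 1
    rw [mul_one, ← hran] at h1
    obtain ⟨m, hm⟩ := h1
    have hm0 : m ≠ 0 := by
      rintro rfl
      rw [map_zero] at hm
      exact hψ.ne_zero hm.symm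
    have := key2 m hm0
    rw [hm, hψ.leadingCoeff, mul_assoc] at this
    exact IsUnit.of_mul_eq_one _ (mul_left_cancel₀ h0 this).symm
  obtain ⟨c, hc, rfl⟩ := Polynomial.isUnit_iff.1 hq
  refine ⟨c, hc.ne_zero, fun m => ?_⟩
  have hmul (w : k[X][X]) : t ⟨C χ * w, C_mul_mem hχ w⟩ = c • (C χ * w) := by
    induction w using X_mul_add_C_induction with
    | zero =>
      have : (⟨C χ * 0, C_mul_mem hχ 0⟩ : d.sub) = 0 := Subtype.ext (mul_zero _)
      rw [this]; simp
    | succ w p ih =>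
      rw [map_C_mul_succ t htX htY hχ, ih, hℓ, aeval_opX_C, smul_eq_C_C_mul, smul_eq_C_C_mul]
      simp only [C_mul]
      ring
  -- Some `g(x)` carries `m` into `χ k[x][y]`, where `t` is known to be the scalar `c`.
  obtain ⟨g, hg, w, hw⟩ := exists_aeval_eq_C_mul hχ h0 (m : k[X][X])
  refine eq_of_aeval_opX_eq d e hg ?_
  rw [map_smul, hw, ← hmul, ← map_aeval t htX]
  exact congrArg t (Subtype.ext hw)

include htX htY in
theorem fn_eq_of_equiv (hinj : Function.Injective t) (hran : LinearMap.range t = e.sub) :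
    d.fn = e.fn := by
  obtain ⟨c, hc, h⟩ := exists_map_eq_smul t htX htY hinj hran
  refine fn_eq_of_eqOn d e fun u hu => ?_
  have h1 := htX ⟨u, hu⟩
  rw [h, h, map_smul] at h1
  exact smul_right_injective _ hc h1

end rigidity

theorem opX_eq (h : d.fn = e.fn) : d.opX = e.opX := by
  refine LinearMap.ext fun u => ?_
  induction u using X_mul_add_C_induction with
  | zero => simp
  | succ u a ih => rw [map_add, map_add, d.opX_X_mul, e.opX_X_mul, ih, h, d.opX_C, e.opX_C]

/-- With a common action of `x`, the commutator relation is exact on `e.sub` because the functional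
vanishes there; the trace argument modulo `d.sub` applies. -/
theorem sub_le [CharZero k] (h : d.fn = e.fn) : e.sub ≤ d.sub := by
  have := d.finite
  refine Submodule.le_of_commutator_sub_mem d.sub e.sub (LinearMap.mulLeft k (X : k[X][X])) d.opX
    d.X_mul_mem d.opX_mem e.X_mul_mem (fun u hu => opX_eq d e h ▸ e.opX_mem u hu) fun u hu => ?_
  have h1 : d.fn u = 0 := h ▸ e.fn_eq_zero u hu
  simp [d.opX_X_mul, h1]

theorem sub_eq [CharZero k] (h : d.fn = e.fn) : d.sub = e.sub :=
  le_antisymm (sub_le e d h.symm) (sub_le d e h)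

end CyclicDatum

/-! ### The basis of ordered monomials of the Weyl algebra. -/

namespace WeylAlgebra

open Polynomial

variable (k : Type u) [Field k]

/-- The linear map `k[x][y] → A` with `x^p y^q ↦ x^p y^q`. -/
noncomputable def ofPoly : k[X][X] →ₗ[k] WeylAlgebra k :=
  Polynomial.lsum fun q => LinearMap.mulRight k (y k ^ q) ∘ₗ (aeval (x k)).toLinearMap

theorem ofPoly_monomial (q : ℕ) (p : k[X]) :
    ofPoly k (monomial q p) = aeval (x k) p * y k ^ q := by
  simp [ofPoly, lsum_apply, sum_monomial_index]

theorem ofPoly_C (p : k[X]) : ofPoly k (C p) = aeval (x k) p := by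
  rw [← monomial_zero_left, ofPoly_monomial, pow_zero, mul_one]

theorem ofPoly_X_mul (u : k[X][X]) : ofPoly k (X * u) = ofPoly k u * y k := by
  induction u using Polynomial.induction_on' with
  | add u v hu hv => rw [mul_add, map_add, map_add, add_mul, hu, hv]
  | monomial n a => rw [X_mul_monomial, ofPoly_monomial, ofPoly_monomial, pow_succ, mul_assoc]

theorem x_mul_y : x k * y k = y k * x k + 1 := sub_eq_iff_eq_add'.1 (x_mul_y_sub k)

theorem exists_ofPoly_mul_x (u : k[X][X]) : ∃ u', ofPoly k u' = ofPoly k u * x k := by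
  induction u using X_mul_add_C_induction with
  | zero => exact ⟨0, by simp⟩
  | succ u p ih =>
    obtain ⟨u', hu⟩ := ih
    refine ⟨X * u' - u + C (X * p), ?_⟩
    rw [map_add, map_sub, map_add, ofPoly_X_mul, ofPoly_X_mul, ofPoly_C, ofPoly_C, hu, add_mul,
      mul_comm X p, map_mul, aeval_X, mul_assoc, x_mul_y, mul_add, mul_assoc]
    simp

theorem ofPoly_surjective : Function.Surjective (ofPoly k) := by
  -- The span of the ordered monomials contains `1` and is stable under right multiplication by the
  -- generators.
  suffices H : ∀ a : WeylAlgebra k, ∀ u, ∃ u', ofPoly k u' = ofPoly k u * a by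
    intro a
    obtain ⟨u, hu⟩ := H a (C 1)
    exact ⟨u, by rw [hu, ofPoly_C, map_one, one_mul]⟩
  intro a
  obtain ⟨a, rfl⟩ := RingQuot.mkAlgHom_surjective k (WeylRel k) a
  induction a using FreeAlgebra.induction with
  | grade0 r =>
    intro u
    exact ⟨r • u, by rw [map_smul, AlgHom.commutes, ← Algebra.commutes, Algebra.smul_def]⟩
  | grade1 t =>
    fin_cases t
    · exact exists_ofPoly_mul_x k
    · exact fun u => ⟨X * u, ofPoly_X_mul k u⟩
  | mul a b ha hb =>
    intro u
    obtain ⟨u₁, h₁⟩ := ha u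
    obtain ⟨u₂, h₂⟩ := hb u₁
    exact ⟨u₂, by rw [h₂, h₁, map_mul, mul_assoc]⟩
  | add a b ha hb =>
    intro u
    obtain ⟨u₁, h₁⟩ := ha u
    obtain ⟨u₂, h₂⟩ := hb u
    exact ⟨u₁ + u₂, by rw [map_add, h₂, h₁, map_add, mul_add]⟩

/-- The right action of the Weyl algebra on `k[x][y]`, where `y` acts by multiplication and `x` by
multiplication minus the derivative with respect to `y`. -/
noncomputable def rightAction : WeylAlgebra k →ₐ[k] (Module.End k k[X][X])ᵐᵒᵖ :=
  RingQuot.liftAlgHom k ⟨FreeAlgebra.lift k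
    ![MulOpposite.op (LinearMap.mulLeft k (C X) - (derivative (R := k[X])).restrictScalars k),
      MulOpposite.op (LinearMap.mulLeft k X)], by
    rintro _ _ ⟨⟩
    refine MulOpposite.unop_injective (LinearMap.ext fun u => ?_)
    simp
    ring⟩

theorem rightAction_x (a : WeylAlgebra k) (u : k[X][X]) :
    (rightAction k (a * x k)).unop u =
      C X * (rightAction k a).unop u - derivative ((rightAction k a).unop u) := by
  rw [map_mul, MulOpposite.unop_mul, Module.End.mul_apply]
  simp [rightAction, x]

theorem rightAction_y (a : WeylAlgebra k) (u : k[X][X]) :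
    (rightAction k (a * y k)).unop u = X * (rightAction k a).unop u := by
  rw [map_mul, MulOpposite.unop_mul, Module.End.mul_apply]
  simp [rightAction, y]

/-- Acting on `1` recovers the polynomial, which proves the ordered monomials independent. -/
theorem rightAction_ofPoly (u : k[X][X]) : (rightAction k (ofPoly k u)).unop 1 = u := by
  induction u using X_mul_add_C_induction with
  | zero => simp
  | succ u p ih =>
    have hp : (rightAction k (ofPoly k (C p))).unop 1 = C p := by
      induction p using X_mul_add_C_induction with
      | zero => simp
      | succ p a hp =>
        rw [ofPoly_C] at hp
        rw [ofPoly_C, mul_comm, map_add, map_mul, aeval_X, aeval_C, map_add, MulOpposite.unop_add,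
          LinearMap.add_apply, rightAction_x, hp, AlgHom.commutes, C_add, C_mul]
        simp only [derivative_C, sub_zero, MulOpposite.algebraMap_apply, MulOpposite.unop_op,
          Module.algebraMap_end_apply, smul_eq_C_C_mul]
        ring
    rw [map_add, map_add, MulOpposite.unop_add, LinearMap.add_apply, ofPoly_X_mul, rightAction_y,
      ih, hp]

/-- The monomials `x^p y^q` form a basis of the Weyl algebra. -/
noncomputable def polyEquiv : k[X][X] ≃ₗ[k] WeylAlgebra k :=
  LinearEquiv.ofBijective (ofPoly k)
    ⟨Function.LeftInverse.injective (g := fun a => (rightAction k a).unop 1) (rightAction_ofPoly k), ofPoly_surjective k⟩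

end WeylAlgebra

/-! ### The action on cohomology, and strict morphisms. -/

namespace AInfModule

variable {k : Type u} [Field k] {A : Type w} [Ring A] [Algebra k A]

theorem op_zero_eq (K : AInfModule.{u, v, w} k A) (u : K.carrier) (a : Fin 0 → A) :
    K.op 0 u a = K.m₁ u := by
  rw [Subsingleton.elim a ![]]; rfl

theorem op_one_eq (K : AInfModule.{u, v, w} k A) (u : K.carrier) (a : Fin 1 → A) :
    K.op 1 u a = K.m₂ u (a 0) := by
  change _ = K.op 1 u ![a 0]
  congr 1; ext t; fin_cases t; rfl

theorem op_two_eq (K : AInfModule.{u, v, w} k A) (u : K.carrier) (a : Fin 2 → A) :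
    K.op 2 u a = K.m₃ u (a 0) (a 1) := by
  change _ = K.op 2 u ![a 0, a 1]
  congr 1; ext t; fin_cases t <;> rfl

theorem m₃_mem (K : AInfModule.{u, v, w} k A) {n : ℤ} {u : K.carrier} (hu : u ∈ K.gr n)
    (a b : A) : K.m₃ u a b ∈ K.gr (n - 1) := by
  have := K.op_mem 2 n u ![a, b] hu
  rwa [show n + 1 - (2 : ℕ) = n - 1 by push_cast; ring] at this

/-- The action of `a ∈ A` on cohomology. -/
def cohomologyAct (K : AInfModule.{u, v, w} k A) (n : ℤ) (a : A) :
    K.cohomology n →ₗ[k] K.cohomology n :=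
  Submodule.mapQ _ _ ((K.m₂.flip a).restrict (p := K.cocycles n) (q := K.cocycles n) fun u hu => by
      refine ⟨K.m₂_mem hu.1 a, ?_⟩
      have h : K.m₁ u = 0 := hu.2
      change K.m₁ (K.m₂ u a) = 0
      rw [K.m₁_m₂, h, map_zero, LinearMap.zero_apply]) <| by
    rintro ⟨u, hu⟩ ⟨w, hw, hwu⟩
    refine ⟨K.m₂ w a, K.m₂_mem hw a, ?_⟩
    rw [K.m₁_m₂, hwu]; rfl

namespace Hom

variable {K L : AInfModule.{u, v, w} k A}

theorem map_zero_eq (f : Hom K L) (u : K.carrier) (a : Fin 0 → A) : f.map 0 u a = f.f₁ u := by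
  rw [Subsingleton.elim a ![]]; rfl

theorem f₁_m₂ (f : Hom K L) (u : K.carrier) (a : A) :
    f.f₁ (K.m₂ u a) = L.m₂ (f.f₁ u) a + L.m₁ (f.map 1 u ![a]) + f.map 1 (K.m₁ u) ![a] := by
  have h := f.relation 1 u (fun _ => a)
  have e1 (s : ℕ → A) : seqHead 1 s = ![s 0] := by ext t; fin_cases t; rfl
  simp [Finset.sum_range_succ, e1, seqTail, map_zero_eq, op_zero_eq, op_one_eq] at h
  rw [← h]; abel

/-- On a cocycle `u` the failure of `f₁` to commute with `a` is the coboundary `m₁ (f₂(u, a))`. -/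
theorem cohomologyMap_act (f : Hom K L) (n : ℤ) (a : A) (c : K.cohomology n) :
    f.cohomologyMap n (K.cohomologyAct n a c) = L.cohomologyAct n a (f.cohomologyMap n c) := by
  obtain ⟨⟨u, hu⟩, rfl⟩ := Submodule.Quotient.mk_surjective _ c
  refine (Submodule.Quotient.eq _).2 ?_
  refine ⟨f.map 1 u ![a], ?_, ?_⟩
  · simpa using f.map_mem 1 n u ![a] hu.1
  · have h : K.m₁ u = 0 := hu.2
    change L.m₁ (f.map 1 u ![a]) = f.f₁ (K.m₂ u a) - L.m₂ (f.f₁ u) a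
    rw [f.f₁_m₂, h]; simp

theorem f₁_comp (g : Hom L K) (f : Hom K L) (h : g.CompIsId f) (u : K.carrier) :
    g.f₁ (f.f₁ u) = u := by
  simpa [compApply, map_zero_eq] using h 0 u (fun _ => 0)

theorem isQuasiIso_of_inverse (f : Hom K L) (g : Hom L K) (h : g.CompIsId f) (h' : f.CompIsId g) :
    f.IsQuasiIso := by
  intro n
  have key {K L : AInfModule.{u, v, w} k A} (f : Hom K L) (g : Hom L K) (h : g.CompIsId f) :
      Function.LeftInverse (g.cohomologyMap n) (f.cohomologyMap n) := by
    intro c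
    obtain ⟨⟨u, hu⟩, rfl⟩ := Submodule.Quotient.mk_surjective _ c
    exact congrArg Submodule.Quotient.mk (Subtype.ext (f₁_comp g f h u))
  exact ⟨(key f g h).injective, (key g f h').surjective⟩

/-- A linear map that commutes with all operations is a strict morphism. -/
def ofStrict (T : K.carrier →ₗ[k] L.carrier) (hT : ∀ p, ∀ u ∈ K.gr p, T u ∈ L.gr p)
    (h : ∀ n u a, T (K.op n u a) = L.op n (T u) a) : Hom K L where
  map n := match n with
    | 0 => (MultilinearMap.constLinearEquivOfIsEmpty k k (fun _ : Fin 0 => A)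
        L.carrier).toLinearMap ∘ₗ T
    | _ + 1 => 0
  map_mem n p u a hu := by
    rcases n with _ | n
    · simpa using hT p u hu
    · exact Submodule.zero_mem _
  relation n u a := by
    rw [Finset.sum_range_succ, Finset.sum_eq_zero, Finset.sum_eq_zero (s := Finset.range n),
      Finset.sum_range_succ', Finset.sum_eq_zero]
    · obtain ⟨m, hm⟩ : ∃ m, m = n - n := ⟨_, rfl⟩
      rw [← hm]
      obtain rfl : m = 0 := by omega
      have h0 : seqTail 0 a = a := by funext t; simp [seqTail]
      simp [h, h0]
    · intro j _
      simp
    · intro j hj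
      have := Finset.mem_range.1 hj
      obtain ⟨m, hm⟩ : ∃ m, n - j = m + 1 := ⟨n - j - 1, by omega⟩
      rw [hm]; simp
    · intro j hj
      have := Finset.mem_range.1 hj
      obtain ⟨m, hm⟩ : ∃ m, n - 1 = m + 1 := ⟨n - 2, by omega⟩
      rw [hm]; simp

theorem ofStrict_isStrict (T : K.carrier →ₗ[k] L.carrier) (hT : ∀ p, ∀ u ∈ K.gr p, T u ∈ L.gr p)
    (h : ∀ n u a, T (K.op n u a) = L.op n (T u) a) : (ofStrict T hT h).IsStrict := by
  intro n hn
  obtain ⟨m, rfl⟩ : ∃ m, n = m + 1 := ⟨n - 1, by omega⟩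
  rfl

theorem compIsId_of_isStrict (g : Hom L K) (f : Hom K L) (hg : g.IsStrict) (hf : f.IsStrict)
    (h : ∀ u, g.f₁ (f.f₁ u) = u) : g.CompIsId f := by
  intro n u a
  rcases n with _ | n
  · simp [compApply, map_zero_eq, h]
  · rw [if_neg n.succ_ne_zero]
    refine Finset.sum_eq_zero fun j _ => ?_
    rcases j with _ | j
    · rw [Nat.sub_zero, hg _ (by omega)]; simp
    · rw [hf (j + 1) (by omega)]; simp

end Hom

theorem strictlyIsomorphic_of_linearEquiv {K L : AInfModule.{u, v, w} k A}
    (T : K.carrier ≃ₗ[k] L.carrier) (hT : ∀ p, ∀ u, u ∈ K.gr p → T u ∈ L.gr p)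
    (hT' : ∀ p, ∀ u, u ∈ L.gr p → T.symm u ∈ K.gr p)
    (h : ∀ n u a, T (K.op n u a) = L.op n (T u) a) : StrictlyIsomorphic K L := by
  have h' : ∀ n u a, T.symm (L.op n u a) = K.op n (T.symm u) a := fun n u a => by
    rw [LinearEquiv.symm_apply_eq, h, T.apply_symm_apply]
  refine ⟨Hom.ofStrict T.toLinearMap hT h, Hom.ofStrict T.symm.toLinearMap hT' h',
    Hom.ofStrict_isStrict _ _ _, Hom.ofStrict_isStrict _ _ _, ?_, ?_⟩
  · exact Hom.compIsId_of_isStrict _ _ (Hom.ofStrict_isStrict _ _ _)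
      (Hom.ofStrict_isStrict _ _ _) T.symm_apply_apply
  · exact Hom.compIsId_of_isStrict _ _ (Hom.ofStrict_isStrict _ _ _)
      (Hom.ofStrict_isStrict _ _ _) T.apply_symm_apply

end AInfModule

namespace AInfModule

variable {k : Type u} [Field k] {A : Type w} [Ring A] [Algebra k A]

/-- The action of `A` identifies the cohomology of `K` with that of `L` in degree `n`. -/
def CohomologyIso (n : ℤ) (K L : AInfModule.{u, v, w} k A) : Prop :=
  ∃ θ : K.cohomology n ≃ₗ[k] L.cohomology n,
    ∀ a c, θ (K.cohomologyAct n a c) = L.cohomologyAct n a (θ c)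

theorem QuasiIsomorphic.cohomologyIso {K L : AInfModule.{u, v, w} k A}
    (h : QuasiIsomorphic K L) (n : ℤ) : CohomologyIso n K L := by
  induction h with
  | rel K L h =>
    obtain ⟨f, hf⟩ := h
    exact ⟨LinearEquiv.ofBijective _ (hf n), f.cohomologyMap_act n⟩
  | refl K => exact ⟨LinearEquiv.refl _ _, fun _ _ => rfl⟩
  | symm K L _ ih =>
    obtain ⟨θ, hθ⟩ := ih
    exact ⟨θ.symm, fun a c => by rw [LinearEquiv.symm_apply_eq, hθ, θ.apply_symm_apply]⟩
  | trans K L N _ _ ih₁ ih₂ =>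
    obtain ⟨θ₁, h₁⟩ := ih₁
    obtain ⟨θ₂, h₂⟩ := ih₂
    exact ⟨θ₁.trans θ₂, fun a c => by simp [h₁, h₂]⟩

end AInfModule

/-! ### From an envelope to the linear model. -/

namespace IsEnvelope

open Polynomial WeylAlgebra

variable {k : Type u} [Field k] {K : AInfModule.{u, v, u} k (WeylAlgebra k)} {i : K.carrier}
  (h : IsEnvelope K i)

include h in
theorem gr_eq_bot_of_neg {p : ℤ} (hp : p < 0) : K.gr p = ⊥ :=
  h.two_term p (by omega) (by omega)

include h in
theorem m₃_eq_zero {u : K.carrier} (hu : u ∈ K.gr 0) (a b : WeylAlgebra k) : K.m₃ u a b = 0 := by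
  have := K.m₃_mem hu a b
  rwa [h.gr_eq_bot_of_neg (by norm_num), Submodule.mem_bot] at this

include h in
theorem m₁_eq_zero {v : K.carrier} (hv : v ∈ K.gr 1) : K.m₁ v = 0 := by
  have := K.m₁_mem hv
  rwa [h.two_term _ (by norm_num) (by norm_num), Submodule.mem_bot] at this

theorem _root_.AInfModule.m₁_mem_one (K : AInfModule.{u, v, u} k (WeylAlgebra k)) {u : K.carrier}
    (hu : u ∈ K.gr 0) : K.m₁ u ∈ K.gr 1 := by simpa using K.m₁_mem hu

include h in
-- For `u` of degree `0` the value `m₃(u, a, b)` lies in `K⁻¹ = 0`, leaving only `m₃` on `m₁ u`.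
theorem m₂_m₂ {u : K.carrier} (hu : u ∈ K.gr 0) (a b : WeylAlgebra k) :
    K.m₂ (K.m₂ u a) b = K.m₂ u (a * b) + K.m₃ (K.m₁ u) a b := by
  have := K.m₂_m₂_sub u a b
  rwa [h.m₃_eq_zero hu, map_zero, add_zero, sub_eq_iff_eq_add'] at this

include h in
theorem m₂_x_mul {u : K.carrier} (hu : u ∈ K.gr 0) (a : WeylAlgebra k) :
    K.m₂ u (x k * a) = K.m₂ (K.m₂ u (x k)) a := by
  rw [h.m₂_m₂ hu, h.assoc_x _ (K.m₁_mem_one hu), add_zero]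

include h in
theorem m₂_mul_y {u : K.carrier} (hu : u ∈ K.gr 0) (a : WeylAlgebra k) :
    K.m₂ u (a * y k) = K.m₂ (K.m₂ u a) (y k) := by
  rw [h.m₂_m₂ hu, h.assoc_y _ (K.m₁_mem_one hu), add_zero]

theorem m₂_y_m₂_x {u : K.carrier} (hu : u ∈ K.gr 0) :
    K.m₂ (K.m₂ u (y k)) (x k) =
      K.m₂ (K.m₂ u (x k)) (y k) - u + h.jbar ⟨K.m₁ u, K.m₁_mem_one hu⟩ • i := by
  rw [h.m₂_m₂ hu, h.jbar_smul, ← h.m₂_mul_y hu, x_mul_y, map_add,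
    show K.m₂ u 1 = u from K.op_one u, add_sub_cancel_right]

include h in
theorem m₂_aeval_x {u : K.carrier} (hu : u ∈ K.gr 0) (p : k[X]) :
    K.m₂ (K.m₂ u (aeval (x k) p)) (x k) = K.m₂ u (aeval (x k) (X * p)) := by
  -- Associativity is available for a first factor `x`, so powers of `x` are peeled off on the left,
  -- which changes `u`.
  induction p using X_mul_add_C_induction generalizing u with
  | zero => simp
  | succ p a ih =>
    have e : aeval (x k) (X * (X * p + C a)) =
        x k * aeval (x k) (X * p) + a • x k := by
      rw [mul_add, map_add, map_mul, aeval_X, mul_comm X (C a), map_mul _ (C a), aeval_C, aeval_X,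
        Algebra.smul_def]
    have e' : aeval (x k) (X * p + C a) = x k * aeval (x k) p + a • 1 := by
      rw [map_add, map_mul, aeval_X, aeval_C, Algebra.algebraMap_eq_smul_one]
    rw [e, e', map_add, map_add, map_add, LinearMap.add_apply, h.m₂_x_mul hu, h.m₂_x_mul hu,
      ih (K.m₂_mem hu _), map_smul, map_smul, map_smul, LinearMap.smul_apply,
      show K.m₂ u 1 = u from K.op_one u]

/-- The isomorphism `k[x][y] ≃ K⁰`, `x^p y^q ↦ i · x^p y^q`. -/
noncomputable def polyEquiv : k[X][X] ≃ₗ[k] K.gr 0 :=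
  (WeylAlgebra.polyEquiv k).trans <| LinearEquiv.ofBijective
    (LinearMap.codRestrict (K.gr 0) (K.m₂ i) fun a => K.m₂_mem h.cyclic_mem a)
    ⟨fun _ _ e => h.cyclic.injOn (Set.mem_univ _) (Set.mem_univ _) (congrArg Subtype.val e),
      fun u => by
        obtain ⟨a, -, ha⟩ := h.cyclic.surjOn u.2
        exact ⟨a, Subtype.ext ha⟩⟩

theorem coe_polyEquiv (u : k[X][X]) : (h.polyEquiv u : K.carrier) = K.m₂ i (ofPoly k u) := rfl

theorem coe_polyEquiv_C (p : k[X]) :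
    (h.polyEquiv (C p) : K.carrier) = K.m₂ i (aeval (x k) p) := by
  rw [coe_polyEquiv, ofPoly_C]

theorem coe_polyEquiv_X_mul (u : k[X][X]) :
    (h.polyEquiv (X * u) : K.carrier) = K.m₂ (h.polyEquiv u) (y k) := by
  rw [coe_polyEquiv, ofPoly_X_mul, h.m₂_mul_y h.cyclic_mem]; rfl

/-- The differential `K⁰ → K¹`. -/
def diff (_h : IsEnvelope K i) : K.gr 0 →ₗ[k] K.gr 1 :=
  K.m₁.restrict fun _ hu => K.m₁_mem_one hu

/-- The action of `x` on `k[x][y] ≃ K⁰`. -/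
noncomputable def opX : Module.End k k[X][X] :=
  h.polyEquiv.symm.toLinearMap ∘ₗ
    (K.m₂.flip (x k)).restrict (fun _ hu => K.m₂_mem hu (x k)) ∘ₗ h.polyEquiv.toLinearMap

theorem coe_polyEquiv_opX (u : k[X][X]) :
    (h.polyEquiv (h.opX u) : K.carrier) = K.m₂ (h.polyEquiv u) (x k) := by
  rw [opX, LinearMap.comp_apply, LinearEquiv.coe_coe, LinearEquiv.apply_symm_apply]; rfl

theorem mem_ker_diff (u : k[X][X]) :
    u ∈ LinearMap.ker (h.diff ∘ₗ h.polyEquiv.toLinearMap) ↔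
      K.m₁ (h.polyEquiv u : K.carrier) = 0 := by
  rw [LinearMap.mem_ker]
  exact Subtype.ext_iff

/-- The linear model of `K⁰`. -/
noncomputable def datum : CyclicDatum k where
  opX := h.opX
  fn := h.lam ∘ₗ ofPoly k
  sub := LinearMap.ker (h.diff ∘ₗ h.polyEquiv.toLinearMap)
  opX_C p := h.polyEquiv.injective <| Subtype.ext <| by
    rw [coe_polyEquiv_opX, coe_polyEquiv_C, coe_polyEquiv_C, h.m₂_aeval_x h.cyclic_mem]
  opX_X_mul u := h.polyEquiv.injective <| Subtype.ext <| by
    rw [coe_polyEquiv_opX, coe_polyEquiv_X_mul, h.m₂_y_m₂_x (h.polyEquiv u).2, map_add, map_sub,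
      Submodule.coe_add, Submodule.coe_sub, coe_polyEquiv_X_mul, coe_polyEquiv_opX,
      coe_polyEquiv_C, aeval_C, Algebra.algebraMap_eq_smul_one, map_smul,
      show K.m₂ i 1 = i from K.op_one i]
    rfl
  opX_mem u hu := by
    rw [mem_ker_diff] at hu ⊢
    rw [coe_polyEquiv_opX, K.m₁_m₂, hu, map_zero, LinearMap.zero_apply]
  X_mul_mem u hu := by
    rw [mem_ker_diff] at hu ⊢
    rw [coe_polyEquiv_X_mul, K.m₁_m₂, hu, map_zero, LinearMap.zero_apply]
  fn_eq_zero u hu := by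
    have : (h.lam ∘ₗ ofPoly k) u = h.jbar ((h.diff ∘ₗ h.polyEquiv.toLinearMap) u) := rfl
    rw [this, LinearMap.mem_ker.1 hu, map_zero]
  finite := by
    have := h.finite
    exact Module.Finite.equiv (LinearMap.quotKerEquivRange
      (h.diff ∘ₗ h.polyEquiv.toLinearMap)).symm

theorem mem_datum_sub (u : k[X][X]) :
    u ∈ h.datum.sub ↔ K.m₁ (h.polyEquiv u : K.carrier) = 0 := h.mem_ker_diff u

/-- The isomorphism of the space of cocycles with `H⁰(K)`. -/
noncomputable def cohomologyEquiv : h.datum.sub ≃ₗ[k] K.cohomology 0 :=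
  LinearEquiv.ofBijective
    (Submodule.mkQ _ ∘ₗ LinearMap.codRestrict (K.cocycles 0)
      ((K.gr 0).subtype ∘ₗ h.polyEquiv.toLinearMap ∘ₗ h.datum.sub.subtype)
      fun u => ⟨(h.polyEquiv u).2, (h.mem_datum_sub u).1 u.2⟩) <| by
    constructor
    · refine (injective_iff_map_eq_zero _).2 fun u hu => ?_
      obtain ⟨w, hw, hwu⟩ := (Submodule.Quotient.mk_eq_zero _).1 hu
      rw [h.gr_eq_bot_of_neg (by norm_num)] at hw
      obtain rfl : w = 0 := hw
      rw [map_zero] at hwu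
      exact Subtype.ext (h.polyEquiv.map_eq_zero_iff.1 (Subtype.ext hwu.symm))
    · intro c
      obtain ⟨⟨u, hu⟩, rfl⟩ := Submodule.Quotient.mk_surjective _ c
      obtain ⟨w, hw⟩ := h.polyEquiv.surjective ⟨u, hu.1⟩
      refine ⟨⟨w, (h.mem_datum_sub w).2 (by rw [hw]; exact hu.2)⟩, ?_⟩
      refine congrArg Submodule.Quotient.mk (Subtype.ext ?_)
      exact congrArg (Subtype.val (p := (· ∈ K.gr 0))) hw

theorem cohomologyEquiv_opX (u : h.datum.sub) :
    h.cohomologyEquiv ⟨h.datum.opX u, h.datum.opX_mem u u.2⟩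
      = K.cohomologyAct 0 (x k) (h.cohomologyEquiv u) :=
  congrArg Submodule.Quotient.mk (Subtype.ext (h.coe_polyEquiv_opX u))

theorem cohomologyEquiv_X_mul (u : h.datum.sub) :
    h.cohomologyEquiv ⟨X * (u : k[X][X]), h.datum.X_mul_mem u u.2⟩
      = K.cohomologyAct 0 (y k) (h.cohomologyEquiv u) :=
  congrArg Submodule.Quotient.mk (Subtype.ext (h.coe_polyEquiv_X_mul u))

variable {L : AInfModule.{u, v, u} k (WeylAlgebra k)} {i' : L.carrier} (h' : IsEnvelope L i')

include h h' in
theorem lam_eq_of_cohomologyIso (H : AInfModule.CohomologyIso 0 K L) : h.lam = h'.lam := by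
  obtain ⟨θ, hθ⟩ := H
  let T : h.datum.sub ≃ₗ[k] h'.datum.sub :=
    h.cohomologyEquiv.trans (θ.trans h'.cohomologyEquiv.symm)
  have hX (u : h.datum.sub) : T ⟨h.datum.opX u, h.datum.opX_mem u u.2⟩
      = ⟨h'.datum.opX (T u), h'.datum.opX_mem _ (T u).2⟩ := by
    refine h'.cohomologyEquiv.injective ?_
    rw [cohomologyEquiv_opX]
    simp [T, cohomologyEquiv_opX, hθ]
  have hY (u : h.datum.sub) : T ⟨X * (u : k[X][X]), h.datum.X_mul_mem u u.2⟩
      = ⟨X * (T u : k[X][X]), h'.datum.X_mul_mem _ (T u).2⟩ := by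
    refine h'.cohomologyEquiv.injective ?_
    rw [cohomologyEquiv_X_mul]
    simp [T, cohomologyEquiv_X_mul, hθ]
  have key := CyclicDatum.fn_eq_of_equiv (d := h.datum) (e := h'.datum)
    (h'.datum.sub.subtype ∘ₗ T.toLinearMap) (fun u => congrArg Subtype.val (hX u))
    (fun u => congrArg Subtype.val (hY u)) (Subtype.val_injective.comp T.injective) (by
      rw [LinearMap.range_comp_of_range_eq_top _ (LinearEquiv.range T), Submodule.range_subtype])
  refine LinearMap.ext fun a => ?_
  obtain ⟨u, rfl⟩ := ofPoly_surjective k a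
  exact LinearMap.congr_fun key u

/-! Envelopes with the same functional are strictly isomorphic. -/

include h in
-- On the finite dimensional `H¹(K)` the defect is a multiple of `m₁(i)`, hence zero; `x` and `y`
-- then have commutator `1`, and the trace forces `H¹(K) = 0`.
theorem diff_surjective [CharZero k] : Function.Surjective h.diff := by
  have := h.finite
  have hstab (a : WeylAlgebra k) : ∀ w ∈ LinearMap.range h.diff,
      h.actBar a w ∈ LinearMap.range h.diff := by
    rintro _ ⟨u, rfl⟩
    exact ⟨⟨K.m₂ u a, K.m₂_mem u.2 a⟩, Subtype.ext (K.m₁_m₂ _ _)⟩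
  rw [← LinearMap.range_eq_top, eq_top_iff]
  refine Submodule.le_of_commutator_sub_mem _ ⊤ (h.actBar (y k)) (h.actBar (x k)) (hstab _)
    (hstab _) (fun _ _ => trivial) (fun _ _ => trivial) fun v _ => ?_
  refine ⟨-(h.jbar v • ⟨i, h.cyclic_mem⟩), Subtype.ext ?_⟩
  have e1 := K.m₂_m₂_sub v (x k) (y k)
  have e2 := K.m₂_m₂_sub v (y k) (x k)
  rw [h.assoc_x _ v.2, h.m₁_eq_zero v.2, map_zero, add_zero] at e1
  rw [← h.jbar_smul, h.m₁_eq_zero v.2] at e2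
  have e0 (a b : WeylAlgebra k) : K.m₃ 0 a b = 0 := by simp [AInfModule.m₃]
  rw [e0, sub_eq_zero, x_mul_y, map_add, show K.m₂ v.1 1 = v from K.op_one v] at e1
  rw [e0, zero_add, sub_eq_iff_eq_add'] at e2
  change K.m₁ (-(h.jbar v • i)) = K.m₂ (K.m₂ v (x k)) (y k) - K.m₂ (K.m₂ v (y k)) (x k) - v
  rw [e1, e2, map_neg]
  abel

include h in
theorem isCompl_gr : IsCompl (K.gr 0) (K.gr 1) := by
  have h1 := K.isInternal.submodule_iSupIndep
  have h2 := K.isInternal.submodule_iSup_eq_top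
  refine ⟨h1.pairwiseDisjoint (by norm_num), codisjoint_iff.2 (top_unique (h2 ▸ ?_))⟩
  refine iSup_le fun p => ?_
  by_cases hp0 : p = 0
  · subst hp0; exact le_sup_left
  · by_cases hp1 : p = 1
    · subst hp1; exact le_sup_right
    · rw [h.two_term p hp0 hp1]; exact bot_le

include h in
theorem op_eq_zero {n : ℕ} (hn : 3 ≤ n) (u : K.carrier) (a : Fin n → WeylAlgebra k) :
    K.op n u a = 0 := by
  have key : ∀ p : ℤ, p ≤ 1 → ∀ u ∈ K.gr p, K.op n u a = 0 := by
    intro p hp u hu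
    have := K.op_mem n p u a hu
    rwa [h.gr_eq_bot_of_neg (by omega), Submodule.mem_bot] at this
  have hu : u ∈ K.gr 0 ⊔ K.gr 1 := by rw [h.isCompl_gr.sup_eq_top]; trivial
  obtain ⟨u₀, h₀, u₁, h₁, rfl⟩ := Submodule.mem_sup.1 hu
  rw [map_add, add_apply, key 0 (by norm_num) _ h₀, key 1 le_rfl _ h₁, add_zero]

section strict

variable (hlam : h.lam = h'.lam)

include hlam in
theorem datum_fn_eq : h.datum.fn = h'.datum.fn :=
  congrArg (· ∘ₗ ofPoly k) hlam

/-- The isomorphism `K⁰ ≃ L⁰`, `i · a ↦ i' · a`. -/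
noncomputable def equivZero : K.gr 0 ≃ₗ[k] L.gr 0 := h.polyEquiv.symm.trans h'.polyEquiv

theorem equivZero_polyEquiv (u : k[X][X]) :
    h.equivZero h' (h.polyEquiv u) = h'.polyEquiv u := by simp [equivZero]

include hlam in
theorem equivZero_x (u : K.gr 0) :
    (h.equivZero h' ⟨K.m₂ u (x k), K.m₂_mem u.2 _⟩ : L.carrier)
      = L.m₂ (h.equivZero h' u) (x k) := by
  obtain ⟨u, rfl⟩ := h.polyEquiv.surjective u
  have e1 : (⟨K.m₂ (h.polyEquiv u) (x k), K.m₂_mem (h.polyEquiv u).2 _⟩ : K.gr 0)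
      = h.polyEquiv (h.opX u) := Subtype.ext (h.coe_polyEquiv_opX u).symm
  have e2 : h.opX = h'.opX := CyclicDatum.opX_eq h.datum h'.datum (datum_fn_eq h h' hlam)
  rw [e1, equivZero_polyEquiv, equivZero_polyEquiv, e2, coe_polyEquiv_opX]

theorem equivZero_y (u : K.gr 0) :
    (h.equivZero h' ⟨K.m₂ u (y k), K.m₂_mem u.2 _⟩ : L.carrier)
      = L.m₂ (h.equivZero h' u) (y k) := by
  obtain ⟨u, rfl⟩ := h.polyEquiv.surjective u
  have e1 : (⟨K.m₂ (h.polyEquiv u) (y k), K.m₂_mem (h.polyEquiv u).2 _⟩ : K.gr 0)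
      = h.polyEquiv (X * u) := Subtype.ext (h.coe_polyEquiv_X_mul u).symm
  rw [e1, equivZero_polyEquiv, equivZero_polyEquiv, coe_polyEquiv_X_mul]

include hlam in
-- As `u(xa) = (ux)a` and `u(ay) = (ua)y`, an ordered monomial acts through its letters, so
-- compatibility with `x` and `y` suffices.
theorem equivZero_m₂ (u : K.gr 0) (a : WeylAlgebra k) :
    (h.equivZero h' ⟨K.m₂ u a, K.m₂_mem u.2 _⟩ : L.carrier) = L.m₂ (h.equivZero h' u) a := by
  have hp (p : k[X]) : ∀ u : K.gr 0, (h.equivZero h' ⟨K.m₂ u (aeval (x k) p), K.m₂_mem u.2 _⟩ :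
      L.carrier) = L.m₂ (h.equivZero h' u) (aeval (x k) p) := by
    induction p using X_mul_add_C_induction with
    | zero =>
      intro u
      have : (⟨K.m₂ u (aeval (x k) (0 : k[X])), K.m₂_mem u.2 _⟩ : K.gr 0) = 0 :=
        Subtype.ext (by simp)
      rw [this]; simp
    | succ p c ih =>
      intro u
      have e' : aeval (x k) (X * p + C c) = x k * aeval (x k) p + c • 1 := by
        rw [map_add, map_mul, aeval_X, aeval_C, Algebra.algebraMap_eq_smul_one]
      have e1 : (⟨K.m₂ u (aeval (x k) (X * p + C c)), K.m₂_mem u.2 _⟩ : K.gr 0)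
          = ⟨K.m₂ (K.m₂ u (x k)) (aeval (x k) p), K.m₂_mem (K.m₂_mem u.2 _) _⟩ + c • u :=
        Subtype.ext (by
          change K.m₂ u _ = K.m₂ (K.m₂ u (x k)) (aeval (x k) p) + c • u.1
          rw [e', map_add, map_smul, h.m₂_x_mul u.2, show K.m₂ u.1 1 = u from K.op_one u.1])
      rw [e1, map_add, map_smul, Submodule.coe_add, ih ⟨K.m₂ u (x k), K.m₂_mem u.2 _⟩,
        equivZero_x h h' hlam, e', map_add, map_smul, h'.m₂_x_mul (h.equivZero h' u).2,
        show L.m₂ (h.equivZero h' u).1 1 = _ from L.op_one _]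
      rfl
  obtain ⟨w, rfl⟩ := ofPoly_surjective k a
  induction w using X_mul_add_C_induction generalizing u with
  | zero =>
    have : (⟨K.m₂ u (ofPoly k 0), K.m₂_mem u.2 _⟩ : K.gr 0) = 0 := Subtype.ext (by simp)
    rw [this]; simp
  | succ w p ih =>
    have e1 : (⟨K.m₂ u (ofPoly k (X * w + C p)), K.m₂_mem u.2 _⟩ : K.gr 0)
        = ⟨K.m₂ (K.m₂ u (ofPoly k w)) (y k), K.m₂_mem (K.m₂_mem u.2 _) _⟩
          + ⟨K.m₂ u (aeval (x k) p), K.m₂_mem u.2 _⟩ := Subtype.ext (by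
      change K.m₂ u _ = K.m₂ (K.m₂ u _) (y k) + K.m₂ u _
      rw [map_add, map_add, ofPoly_X_mul, h.m₂_mul_y u.2, ofPoly_C])
    rw [e1, map_add, Submodule.coe_add, hp,
      equivZero_y h h' ⟨K.m₂ u (ofPoly k w), K.m₂_mem u.2 _⟩, ih, map_add, map_add, ofPoly_X_mul,
      h'.m₂_mul_y (h.equivZero h' u).2, ofPoly_C]

variable [CharZero k]

include hlam in
theorem map_ker_diff :
    (LinearMap.ker h.diff).map (h.equivZero h').toLinearMap = LinearMap.ker h'.diff := by
  have key : h.datum.sub = h'.datum.sub :=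
    CyclicDatum.sub_eq h.datum h'.datum (datum_fn_eq h h' hlam)
  ext w
  obtain ⟨w, rfl⟩ := h'.polyEquiv.surjective w
  have e1 : h'.polyEquiv w ∈ LinearMap.ker h'.diff ↔ w ∈ h'.datum.sub := Iff.rfl
  have e2 : h.polyEquiv w ∈ LinearMap.ker h.diff ↔ w ∈ h.datum.sub := Iff.rfl
  rw [e1, ← key, ← e2, ← equivZero_polyEquiv h h', Submodule.mem_map]
  constructor
  · rintro ⟨u, hu, e⟩
    rwa [← (h.equivZero h').injective e]
  · exact fun hu => ⟨_, hu, rfl⟩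

/-- The isomorphism `K¹ ≃ L¹` induced by `K⁰ ≃ L⁰`. -/
noncomputable def equivOne : K.gr 1 ≃ₗ[k] L.gr 1 :=
  (LinearMap.quotKerEquivOfSurjective h.diff h.diff_surjective).symm.trans <|
    (Submodule.Quotient.equiv _ _ (h.equivZero h') (map_ker_diff h h' hlam)).trans
      (LinearMap.quotKerEquivOfSurjective h'.diff h'.diff_surjective)

theorem equivOne_diff (u : K.gr 0) :
    equivOne h h' hlam (h.diff u) = h'.diff (h.equivZero h' u) := by
  have : (LinearMap.quotKerEquivOfSurjective h.diff h.diff_surjective).symm (h.diff u)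
      = Submodule.Quotient.mk u := by
    rw [LinearEquiv.symm_apply_eq]; rfl
  rw [equivOne, LinearEquiv.trans_apply, this]
  rfl

/-- The isomorphism `K ≃ L` of graded spaces. -/
noncomputable def equiv : K.carrier ≃ₗ[k] L.carrier :=
  (Submodule.prodEquivOfIsCompl _ _ h.isCompl_gr).symm.trans <|
    ((h.equivZero h').prodCongr (equivOne h h' hlam)).trans
      (Submodule.prodEquivOfIsCompl _ _ h'.isCompl_gr)

theorem equiv_zero (u : K.gr 0) : equiv h h' hlam u = h.equivZero h' u := by
  simp [equiv]

theorem equiv_one (v : K.gr 1) : equiv h h' hlam v = equivOne h h' hlam v := by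
  simp [equiv]

theorem equiv_mem (p : ℤ) (u : K.carrier) (hu : u ∈ K.gr p) : equiv h h' hlam u ∈ L.gr p := by
  by_cases hp0 : p = 0
  · subst hp0; rw [equiv_zero h h' hlam ⟨u, hu⟩]; exact Subtype.property _
  · by_cases hp1 : p = 1
    · subst hp1; rw [equiv_one h h' hlam ⟨u, hu⟩]; exact Subtype.property _
    · rw [h.two_term p hp0 hp1] at hu
      obtain rfl : u = 0 := hu
      rw [map_zero]; exact Submodule.zero_mem _

theorem equiv_symm_mem (p : ℤ) (u : L.carrier) (hu : u ∈ L.gr p) :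
    (equiv h h' hlam).symm u ∈ K.gr p := by
  by_cases hp0 : p = 0
  · subst hp0
    obtain ⟨w, hw⟩ := (h.equivZero h').surjective ⟨u, hu⟩
    have : u = equiv h h' hlam w := by rw [equiv_zero, hw]
    rw [this, LinearEquiv.symm_apply_apply]; exact w.2
  · by_cases hp1 : p = 1
    · subst hp1
      obtain ⟨w, hw⟩ := (equivOne h h' hlam).surjective ⟨u, hu⟩
      have : u = equiv h h' hlam w := by rw [equiv_one, hw]
      rw [this, LinearEquiv.symm_apply_apply]; exact w.2
    · rw [h'.two_term p hp0 hp1] at hu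
      obtain rfl : u = 0 := hu
      rw [map_zero]; exact Submodule.zero_mem _

theorem equiv_m₁ (u : K.gr 0) : equiv h h' hlam (K.m₁ u) = L.m₁ (equiv h h' hlam u) := by
  rw [equiv_zero]
  exact (equiv_one h h' hlam (h.diff u)).trans (congrArg Subtype.val (equivOne_diff h h' hlam u))

theorem equiv_m₂_zero (u : K.gr 0) (a : WeylAlgebra k) :
    equiv h h' hlam (K.m₂ u a) = L.m₂ (equiv h h' hlam u) a := by
  rw [equiv_zero, ← equivZero_m₂ h h' hlam]
  exact equiv_zero h h' hlam ⟨K.m₂ u a, K.m₂_mem u.2 _⟩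

include h in
theorem exists_m₁_eq (v : K.gr 1) : ∃ u : K.gr 0, (v : K.carrier) = K.m₁ u := by
  obtain ⟨u, rfl⟩ := h.diff_surjective v
  exact ⟨u, rfl⟩

theorem equiv_m₂_one (v : K.gr 1) (a : WeylAlgebra k) :
    equiv h h' hlam (K.m₂ v a) = L.m₂ (equiv h h' hlam v) a := by
  obtain ⟨u, hu⟩ := h.exists_m₁_eq v
  have := equiv_m₁ h h' hlam ⟨K.m₂ u a, K.m₂_mem u.2 _⟩
  rw [hu, ← K.m₁_m₂, this, equiv_m₂_zero, L.m₁_m₂, equiv_m₁]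

/-- Write `v = m₁ u`: then `m₃(v, a, b)` is the associator of `m₂` at `u`, which the isomorphism
respects. -/
theorem equiv_m₃_one (v : K.gr 1) (a b : WeylAlgebra k) :
    equiv h h' hlam (K.m₃ v a b) = L.m₃ (equiv h h' hlam v) a b := by
  obtain ⟨u, hu⟩ := h.exists_m₁_eq v
  have h1 := h.m₂_m₂ u.2 a b
  have h2 := h'.m₂_m₂ (equiv_mem h h' hlam 0 u u.2) a b
  rw [← equiv_m₁, ← equiv_m₂_zero, ← equiv_m₂_zero,
    ← equiv_m₂_zero h h' hlam ⟨K.m₂ u a, K.m₂_mem u.2 _⟩, h1, map_add] at h2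
  rw [hu]
  exact add_left_cancel h2

theorem equiv_op (n : ℕ) (u : K.carrier) (a : Fin n → WeylAlgebra k) :
    equiv h h' hlam (K.op n u a) = L.op n (equiv h h' hlam u) a := by
  have hu : u ∈ K.gr 0 ⊔ K.gr 1 := by rw [h.isCompl_gr.sup_eq_top]; trivial
  suffices H : (∀ u : K.gr 0, equiv h h' hlam (K.op n u a) = L.op n (equiv h h' hlam u) a) ∧
      ∀ u : K.gr 1, equiv h h' hlam (K.op n u a) = L.op n (equiv h h' hlam u) a by
    obtain ⟨u₀, h₀, u₁, h₁, rfl⟩ := Submodule.mem_sup.1 hu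
    simp only [map_add, add_apply]
    rw [H.1 ⟨u₀, h₀⟩, H.2 ⟨u₁, h₁⟩]
  match n, a with
  | 0, a =>
    simp only [AInfModule.op_zero_eq]
    refine ⟨equiv_m₁ h h' hlam, fun v => ?_⟩
    rw [h.m₁_eq_zero v.2, h'.m₁_eq_zero (equiv_mem h h' hlam 1 v v.2), map_zero]
  | 1, a =>
    simp only [AInfModule.op_one_eq]
    exact ⟨fun u => equiv_m₂_zero h h' hlam u _, fun u => equiv_m₂_one h h' hlam u _⟩
  | 2, a =>
    simp only [AInfModule.op_two_eq]
    refine ⟨fun u => ?_, fun u => equiv_m₃_one h h' hlam u _ _⟩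
    rw [h.m₃_eq_zero u.2, h'.m₃_eq_zero (equiv_mem h h' hlam 0 u u.2), map_zero]
  | n + 3, a =>
    simp only [h.op_eq_zero (Nat.le_add_left 3 n), h'.op_eq_zero (Nat.le_add_left 3 n), map_zero,
      implies_true, and_self]

include h h' hlam in
theorem strictlyIsomorphic_of_lam_eq : AInfModule.StrictlyIsomorphic K L :=
  AInfModule.strictlyIsomorphic_of_linearEquiv (equiv h h' hlam) (equiv_mem h h' hlam)
    (equiv_symm_mem h h' hlam) (equiv_op h h' hlam)

end strict

end IsEnvelope

theorem theorem3 {k : Type u} [Field k] [IsAlgClosed k] [CharZero k]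
    (K L : AInfModule.{u, v, u} k (WeylAlgebra k)) (i : K.carrier) (i' : L.carrier)
    (hK : IsEnvelope K i) (hL : IsEnvelope L i') :
    List.TFAE [
      AInfModule.StrictlyIsomorphic K L,
      AInfModule.Isomorphic K L,
      ∃ f : AInfModule.Hom K L, f.IsQuasiIso,
      AInfModule.QuasiIsomorphic K L,
      hK.lam = hL.lam] := by
  tfae_have 1 → 2 := fun ⟨f, g, _, _, h, h'⟩ => ⟨f, g, h, h'⟩
  tfae_have 2 → 3 := fun ⟨f, g, h, h'⟩ => ⟨f, f.isQuasiIso_of_inverse g h h'⟩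
  tfae_have 3 → 4 := fun h => Relation.EqvGen.rel _ _ h
  -- A zigzag enters only through the isomorphism it induces on `H⁰`, so its intermediate modules
  -- need not be envelopes.
  tfae_have 4 → 5 := fun h => hK.lam_eq_of_cohomologyIso hL (h.cohomologyIso 0)
  tfae_have 5 → 1 := fun h => hK.strictlyIsomorphic_of_lam_eq hL h
  tfae_finish
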